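/- \textbf{Setting.} Let $\Omega\subset\mathbb R^n$ be open and bounded, $A\subset\mathbb R^m$ compact, $a_0\in A$, $\hat A=A\setminus\{a_0\}$. Let $f:\overline\Omega\times A\to\mathbb R^n$ be Lipschitz in $x$ (uniformly in $a$) and continuous in $a$, and let $q:\overline\Omega\to[0,q_2]$ and $K:\overline\Omega\times A\to[0,K_2]$ be lower semicontinuous, with $f(x,a_0)=0$ and $K(x,a_0)=0$ for all $x\in\overline\Omega$. An admissible control for $x\in\overline\Omega$ is a measurable $a(\cdot)$ with values in $A$ together with a trajectory $y'=f(y,a)$, $y(0)=x$, such that $y(t)\in\overline\Omega$ for all $t\ge 0$. Put $$\omega(t)=\int_0^tK(y(s),a(s))\,ds+q(y(t)),\qquad J^\lambda(x,a(\cdot))=\int_0^\infty\lambda e^{-\lambda t}\omega(t)\,dt\quad(\lambda>0),$$ $v^\lambda(x)=\inf_{a(\cdot)}J^\lambda(x,a(\cdot))$ for $\lambda>0$, and $v^0(x)=\inf_{a(\cdot),\,T\ge0}\omega(T)$ (the value function of the undiscounted deterministic optimal stopping problem); the infima are over the admissible controls for $x$. A control is eventually motionless (e.m.) if for some $T\ge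 0$ one has $a(t)=a_0$ for all $t\ge T$; it then becomes motionless at $y(T)$. It is $\lambda$-optimal if $J^\lambda(x,a(\cdot))=v^\lambda(x)$, where $J^0=\omega(T)$ for an e.m. control. Let $M^\lambda=\{x\in\overline\Omega: v^\lambda(x)=q(x)\}$ for $\lambda\ge 0$. For $x\in\overline\Omega$, $a\in A$ let $$D_+^aq(x)=\liminf_{t\to0^+}\frac{q(x+tf(x,a))-q(x)}{t},\qquad H_+^aq(x)=\liminf_{t\to0^+,\,b\to f(x,a)}\frac{q(x+tb)-q(x)}{t}$$ in $[-\infty,+\infty]$, over those $t>0$, resp. $(t,b)$ with $t>0$, for which $x+tf(x,a)$, resp. $x+tb$, lies in $\overline\Omega$ (and $+\infty$ if there are none near the limit), and let $$M^\infty=\{x\in\overline\Omega:\inf_{a\in\hat A}(K(x,a)+D_+^aq(x))\ge0\},\qquad M^\infty_0=\{x\in\overline\Omega: K(x,a)+H_+^aq(x)>0\ \ \forall a\in\hat A\}.$$ \textbf{Theorem.} Suppose that for every $x\in\Omega$ and every $\lambda\ge0$ there is an e.m. $\lambda$-optimal control. Then: 1. Let $\lambda\ge0$, $x\in\overline\Omega$,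 and let $a(\cdot)$ be an e.m. $\lambda$-optimal control for $x$ with $a(t)=a_0$ for $t\ge t_0$ and trajectory $y$. Then $\omega(t_0)\le\omega(t)$ and $q(y(t_0))\le q(y(t))$ for all $t\in[0,t_0)$. If $\inf_{\overline\Omega\times\hat A}K>0$, the second inequality is strict for every $t\in[0,t_0)$ such that it is not the case that $a=a_0$ almost everywhere on $(t,\infty)$. 2. $v^0(x)\le v^\lambda(x)\le q(x)$ for all $\lambda>0$, $x\in\overline\Omega$. 3. If $0\le\lambda_1\le\lambda_2$, then $v^{\lambda_1}\le v^{\lambda_2}$ on $\overline\Omega$. 4. $v^\lambda(x)\to q(x)$ as $\lambda\to+\infty$, for every $x\in\overline\Omega$. 5. $v^\lambda(x)\to v^0(x)$ as $\lambda\to0^+$, for every $x\in\overline\Omega$. 6. If $0\le\lambda_1\le\lambda_2$, then $M^{\lambda_1}\subset M^{\lambda_2}$; in particular $M^0\subset M^\lambda$ for all $\lambda>0$. Moreover, for all $\lambda\ge 0$, every point $x\in M^\lambda\cap\Omega$ such that $q$ is Lipschitz near $x$ and $K(\cdot,a)$ is continuous at $x$ for every $a\in\hat A$ belongs to $M^\infty$.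 7. Suppose the problem is isotropic, i.e. the control values in $\hat A$ are the unit vectors of $\mathbb R^n$ (up to a homeomorphism $u\leftrightarrow a$ of $S_{n-1}$ with $\hat A$) and, for all $x\in\overline\Omega$ and all $u\in S_{n-1}$, the control value $a$ corresponding to $u$ has velocity $f(x,a)=s(x)u$ and running cost $K(x,a)=k(x)$ for some functions $s\ge0$ and $k$; and suppose $\inf_{\Omega\times\hat A}K>0$. Then every $x\in M^\infty_0$ belongs to $M^\lambda$ for all sufficiently large $\lambda$. 8. Every $x\in\overline\Omega\setminus M^0$ lies outside $M^\lambda$ for all sufficiently small $\lambda>0$. 9. Every global minimum point of $q$ on $\overline\Omega$ lies in $M^0$, and every local minimum point of $q$ in $\overline\Omega$ lies in $M^\infty$. If $K\equiv0$ and, in addition, $|f|$ is bounded and there is $F_1>0$ such that for all $x\in\overline\Omega$ and all unit vectors $u$ there is $a\in A$ with $u\cdot f(x,a)=|f(x,a)|\ge F_1$, then every point of $M^\infty_0$ is a strict local minimum point of $q$ in $\overline\Omega$. -/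

import Mathlib

open Set Filter Topology MeasureTheory

noncomputable section

/-- Data of a controlled process in `ℝⁿ` with control values in `ℝᵐ`: the open domain `Ω`,
the set `A` of control values, the motionless control `a₀`, the velocity `f`, the running cost
`K` and the terminal cost `q`.  The functions are only meaningful for states in `closure Ω` and
control values in `A`. -/
structure ControlProblem (n m : ℕ) where
  Ω : Set (EuclideanSpace ℝ (Fin n))
  A : Set (EuclideanSpace ℝ (Fin m))
  a₀ : EuclideanSpace ℝ (Fin m)
  f : EuclideanSpace ℝ (Fin n) → EuclideanSpace ℝ (Fin m) → EuclideanSpace ℝ (Fin n)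
  K : EuclideanSpace ℝ (Fin n) → EuclideanSpace ℝ (Fin m) → ℝ
  q : EuclideanSpace ℝ (Fin n) → ℝ

namespace ControlProblem

variable {n m : ℕ} (P : ControlProblem n m)

/-- The standing assumptions on the data. -/
structure Standing : Prop where
  isOpen : IsOpen P.Ω
  isBounded : Bornology.IsBounded P.Ω
  isCompact : IsCompact P.A
  mem : P.a₀ ∈ P.A
  /-- the velocity is Lipschitz in the state, uniformly in the control value -/
  lipschitz : ∃ L : NNReal, ∀ a ∈ P.A, LipschitzOnWith L (fun x => P.f x a) (closure P.Ω)
  /-- the velocity is continuous in the control value -/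
  continuous : ∀ x ∈ closure P.Ω, ContinuousOn (P.f x) P.A
  q_lsc : LowerSemicontinuousOn P.q (closure P.Ω)
  K_lsc : LowerSemicontinuousOn (Function.uncurry P.K) (closure P.Ω ×ˢ P.A)
  q_nonneg : ∀ x ∈ closure P.Ω, 0 ≤ P.q x
  q_bdd : ∃ q₂ : ℝ, ∀ x ∈ closure P.Ω, P.q x ≤ q₂
  K_nonneg : ∀ x ∈ closure P.Ω, ∀ a ∈ P.A, 0 ≤ P.K x a
  K_bdd : ∃ K₂ : ℝ, ∀ x ∈ closure P.Ω, ∀ a ∈ P.A, P.K x a ≤ K₂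
  f_motionless : ∀ x ∈ closure P.Ω, P.f x P.a₀ = 0
  K_motionless : ∀ x ∈ closure P.Ω, P.K x P.a₀ = 0

/-- The velocity is bounded and motion in every direction is possible, with speed at least
some `F₁ > 0`. -/
def Controllable : Prop :=
  (∃ F₂ : ℝ, ∀ x ∈ closure P.Ω, ∀ a ∈ P.A, ‖P.f x a‖ ≤ F₂) ∧
  ∃ F₁ : ℝ, 0 < F₁ ∧ ∀ x ∈ closure P.Ω, ∀ u : EuclideanSpace ℝ (Fin n), ‖u‖ = 1 →
    ∃ a ∈ P.A, inner ℝ u (P.f x a) = ‖P.f x a‖ ∧ F₁ ≤ ‖P.f x a‖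

/-- The infimum of the running cost over the states in `S` and the control values other
than `a₀` (equal to `⊤` if there is no such pair). -/
def infRunningCost (S : Set (EuclideanSpace ℝ (Fin n))) : EReal :=
  ⨅ x ∈ S, ⨅ a ∈ P.A \ {P.a₀}, (P.K x a : EReal)

/-- Isotropic cost and dynamics.  The control values other than `a₀` are the directions
`u ∈ S_{n-1}` (through the embedding `e`, which is the inclusion when `m = n` and
`A = S_{n-1} ∪ {a₀}`); the speed and the running cost do not depend on the direction. -/
def IsIsotropic : Prop :=
  ∃ (e : Metric.sphere (0 : EuclideanSpace ℝ (Fin n)) 1 → EuclideanSpace ℝ (Fin m))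
    (speed cost : EuclideanSpace ℝ (Fin n) → ℝ),
    Continuous e ∧ Function.Injective e ∧ Set.range e = P.A \ {P.a₀} ∧
    ∀ x ∈ closure P.Ω, 0 ≤ speed x ∧
      ∀ u : Metric.sphere (0 : EuclideanSpace ℝ (Fin n)) 1,
        P.f x (e u) = speed x • (u : EuclideanSpace ℝ (Fin n)) ∧ P.K x (e u) = cost x

/-- `a` is a measurable control with values in `A`, admissible for the starting point `x`, and
`y` is the corresponding trajectory: `y' = f(y, a)`, `y(0) = x`, and `y` never leaves
`closure Ω`. -/
structure IsTrajectory (x : EuclideanSpace ℝ (Fin n)) (a : ℝ → EuclideanSpace ℝ (Fin m))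
    (y : ℝ → EuclideanSpace ℝ (Fin n)) : Prop where
  measurable : Measurable a
  mem_controls : ∀ t, a t ∈ P.A
  continuousOn : ContinuousOn y (Ici 0)
  mem_closure : ∀ t, 0 ≤ t → y t ∈ closure P.Ω
  eq_integral : ∀ t, 0 ≤ t → y t = x + ∫ s in (0 : ℝ)..t, P.f (y s) (a s)

/-- The deterministic cost `ω(t)` of a control if the termination happens at the time `t`. -/
def omega (a : ℝ → EuclideanSpace ℝ (Fin m)) (y : ℝ → EuclideanSpace ℝ (Fin n)) (t : ℝ) : ℝ :=
  (∫ s in (0 : ℝ)..t, P.K (y s) (a s)) + P.q (y t)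

/-- The expected cost for an exponentially distributed termination time with rate `lam > 0`. -/
def expectedCost (lam : ℝ) (a : ℝ → EuclideanSpace ℝ (Fin m))
    (y : ℝ → EuclideanSpace ℝ (Fin n)) : ℝ :=
  ∫ t in Ioi (0 : ℝ), lam * Real.exp (-lam * t) * P.omega a y t

/-- The value function of the randomly-terminated problem with rate `lam > 0`. -/
def randomValue (lam : ℝ) (x : EuclideanSpace ℝ (Fin n)) : ℝ :=
  sInf {c | ∃ a y, P.IsTrajectory x a y ∧ c = P.expectedCost lam a y}

/-- The value function of the deterministic undiscounted optimal stopping problem. -/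
def stoppingValue (x : EuclideanSpace ℝ (Fin n)) : ℝ :=
  sInf {c | ∃ a y T, P.IsTrajectory x a y ∧ 0 ≤ T ∧ c = P.omega a y T}

/-- The value functions `v^λ`, `λ ≥ 0`. -/
def value (lam : ℝ) (x : EuclideanSpace ℝ (Fin n)) : ℝ :=
  if lam = 0 then P.stoppingValue x else P.randomValue lam x

/-- `a` is a `λ`-optimal eventually motionless control for the starting point `x`, equal to `a₀`
from the time `T` on, and `y` is its trajectory.  The cost of such a control for `λ = 0` is
`ω(T)`, the limit of its expected costs as `λ → 0`. -/
structure IsOptimalEM (lam : ℝ) (x : EuclideanSpace ℝ (Fin n))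
    (a : ℝ → EuclideanSpace ℝ (Fin m)) (y : ℝ → EuclideanSpace ℝ (Fin n)) (T : ℝ) : Prop where
  trajectory : P.IsTrajectory x a y
  time_nonneg : 0 ≤ T
  motionless : ∀ t, T ≤ t → a t = P.a₀
  optimal : (if lam = 0 then P.omega a y T else P.expectedCost lam a y) = P.value lam x

/-- The motionless set `M^λ`, `λ ≥ 0`. -/
def motionless (lam : ℝ) : Set (EuclideanSpace ℝ (Fin n)) :=
  {x ∈ closure P.Ω | P.value lam x = P.q x}

/-- Lower Dini derivative of `q : closure Ω → ℝ` at `x` along `f(x, a)`. -/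
def dini (x : EuclideanSpace ℝ (Fin n)) (a : EuclideanSpace ℝ (Fin m)) : EReal :=
  liminf (fun t : ℝ => (((P.q (x + t • P.f x a) - P.q x) / t : ℝ) : EReal))
    (𝓝[{t : ℝ | 0 < t ∧ x + t • P.f x a ∈ closure P.Ω}] 0)

/-- Lower Hadamard derivative of `q : closure Ω → ℝ` at `x` along `f(x, a)`. -/
def hadamard (x : EuclideanSpace ℝ (Fin n)) (a : EuclideanSpace ℝ (Fin m)) : EReal :=
  liminf (fun p : ℝ × EuclideanSpace ℝ (Fin n) =>
      (((P.q (x + p.1 • p.2) - P.q x) / p.1 : ℝ) : EReal))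
    (𝓝[{p : ℝ × EuclideanSpace ℝ (Fin n) | 0 < p.1 ∧ x + p.1 • p.2 ∈ closure P.Ω}]
      (0, P.f x a))

/-- The set `M^∞`. -/
def motionlessInf : Set (EuclideanSpace ℝ (Fin n)) :=
  {x ∈ closure P.Ω | 0 ≤ ⨅ a ∈ P.A \ {P.a₀}, ((P.K x a : EReal) + P.dini x a)}

/-- The set `M^∞_0`.  Positivity of the minimum over the control values other than `a₀` is
written as positivity at each of them. -/
def motionlessInfStrict : Set (EuclideanSpace ℝ (Fin n)) :=
  {x ∈ closure P.Ω | ∀ a ∈ P.A \ {P.a₀}, 0 < (P.K x a : EReal) + P.hadamard x a}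

/-- Points of `Ω` near which `q` is Lipschitz and at which every `K(·, a)`, `a ≠ a₀`, is
continuous. -/
def regularPoints : Set (EuclideanSpace ℝ (Fin n)) :=
  {x ∈ P.Ω | (∃ C : NNReal, ∃ U ∈ 𝓝 x, LipschitzOnWith C P.q U) ∧
    ∀ a ∈ P.A \ {P.a₀}, ContinuousAt (fun z => P.K z a) x}

/-- Global minima of `q` in `closure Ω`. -/
def globalMinima : Set (EuclideanSpace ℝ (Fin n)) :=
  {x ∈ closure P.Ω | IsMinOn P.q (closure P.Ω) x}

/-- Local minima of `q` in `closure Ω`. -/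
def localMinima : Set (EuclideanSpace ℝ (Fin n)) :=
  {x ∈ closure P.Ω | IsLocalMinOn P.q (closure P.Ω) x}

/-- Strict local minima of `q` in `closure Ω`. -/
def strictLocalMinima : Set (EuclideanSpace ℝ (Fin n)) :=
  {x ∈ closure P.Ω | ∀ᶠ z in 𝓝[closure P.Ω \ {x}] x, P.q x < P.q z}

end ControlProblem

end

/-!
The cost `ω` of a control enters the expected cost only through the exponential mean
`expMean lam ω = ∫ lam e^{-lam t} ω(t) dt`, and an admissible control may be stopped at any time `τ`
(`IsTrajectory.stopped`), which replaces `ω(t)` by `ω(min t τ)`.  The assertions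
come from comparing a control with stopped ones, or from bounds on `ω` that hold for every control.

*Optimal trajectories.*  If `ω` were smaller at some time than at the time `t₀` from which on the
control is motionless, then stopping at the time at which the lower semicontinuous function `ω` is
least on `[0, t₀]` would be strictly better (`IsOptimalEM.omega_le`).

*Dependence on the rate.*  The minimum of two independent exponential times of rates `lam₁` and
`lam₂ - lam₁` is exponential of rate `lam₂`.  Therefore the expected cost of a control for `lam₂` is
an average over `τ` of the expected costs for `lam₁` of the control stopped at `τ`, none of which is
below `v^{lam₁}` (`expMean_expMean_stopped`, `Standing.value_mono`).  For large rates the process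
ends before it can leave a neighbourhood on which `q` is nearly at least `q(x)`
(`Standing.tendsto_value_atTop`); for small rates a control stopped at a fixed time `T` costs nearly
`ω(T)` (`Standing.tendsto_value_zero`).

*Motionless points are stationary.*  At an interior point any control value `b` can be used for a
short time `t`, by the Picard–Lindelöf theorem.  The trajectory is tangent to `f(x, b)`, and the
process ends before `t` only with a probability of order `t`, while the cost has by then changed by
an amount of order `t`; so, up to `o(t)`, the assertion that this is not better than standing still
says `q(x) ≤ t K(x, b) + q(x + t f(x, b))` (`Standing.motionless_regular_subset`).

*Strictly stationary points.*  By compactness of the set of velocities, positivity of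
`K + H₊q` at each control value is uniform (`exists_uniform_growth`).  If `K = 0` and all directions
are available, this is growth of `q` away from `x`.  In the isotropic case it gives a `θ` such that
near `x` the running cost per unit length is at least `θ` while `q` decreases by less than `θ` per
unit length (`Standing.exists_cost_bounds`).  Consequently `ω(t) ≥ q(x) + c |y(t) - x|` until the
trajectory leaves a ball about `x` at some time `σ`.  As the speed is bounded, there is a constant
excess over `q(x)` during a time interval of fixed length before `σ`, and for large `lam` its weight
dominates the weight `e^{-lam σ}` of everything after `σ`
(`Standing.mem_motionless_of_cost_bounds`).  Where the speed vanishes, Gronwall's inequality shows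
that the process cannot move.
-/

namespace ControlProblem

/-! ### Means with respect to an exponential law -/

/-- The mean of `W` at an exponentially distributed time of rate `lam`; for `W = ω` it is by
definition the expected cost of a control. -/
noncomputable def expMean (lam : ℝ) (W : ℝ → ℝ) : ℝ :=
  ∫ t in Ioi (0 : ℝ), lam * Real.exp (-lam * t) * W t

/-- `W` has a mean at exponentially distributed times of every rate. -/
def ExpIntegrable (W : ℝ → ℝ) : Prop :=
  ∀ lam : ℝ, 0 < lam → IntegrableOn (fun t => lam * Real.exp (-lam * t) * W t) (Ioi 0)

lemma integrableOn_expDensity {lam : ℝ} (hl : 0 < lam) (a : ℝ) :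
    IntegrableOn (fun t => lam * Real.exp (-lam * t)) (Ioi a) :=
  (integrableOn_exp_mul_Ioi (neg_lt_zero.2 hl) a).const_mul lam

lemma integral_expDensity_Ioi {lam : ℝ} (hl : 0 < lam) (a : ℝ) :
    ∫ t in Ioi a, lam * Real.exp (-lam * t) = Real.exp (-lam * a) := by
  rw [integral_const_mul, integral_exp_mul_Ioi (neg_lt_zero.2 hl)]
  field_simp

lemma integral_expDensity_Ioc {lam : ℝ} (hl : 0 < lam) {a b : ℝ} (hab : a ≤ b) :
    ∫ t in Ioc a b, lam * Real.exp (-lam * t) = Real.exp (-lam * a) - Real.exp (-lam * b) := by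
  have h := setIntegral_union (Ioc_disjoint_Ioi (le_refl b) (a := a)) measurableSet_Ioi
    ((integrableOn_expDensity hl a).mono_set Ioc_subset_Ioi_self) (integrableOn_expDensity hl b)
  rw [Ioc_union_Ioi_eq_Ioi hab, integral_expDensity_Ioi hl, integral_expDensity_Ioi hl] at h
  linarith

lemma expIntegrable_of_linear_growth {W : ℝ → ℝ} {b c : ℝ}
    (hm : AEStronglyMeasurable W (volume.restrict (Ioi 0)))
    (hW : ∀ t, 0 < t → |W t| ≤ b + c * t) : ExpIntegrable W := by
  intro lam hl
  -- real powers, as in the Gamma integrals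
  have h1 : IntegrableOn (fun t : ℝ => lam * b * Real.exp (-lam * t)
      + lam * c * (t ^ (1 : ℝ) * Real.exp (-lam * t ^ (1 : ℝ)))) (Ioi 0) :=
    ((integrableOn_exp_mul_Ioi (neg_lt_zero.2 hl) 0).const_mul _).add
      ((integrableOn_rpow_mul_exp_neg_mul_rpow (by norm_num) one_pos hl).const_mul _)
  refine Integrable.mono' h1 ?_ ?_
  · exact AEStronglyMeasurable.mul (by fun_prop) hm
  · refine (ae_restrict_iff' measurableSet_Ioi).2 (Eventually.of_forall fun t ht => ?_)
    simp only [Real.rpow_one, Real.norm_eq_abs, abs_mul, Real.abs_exp, abs_of_pos hl]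
    have := mul_le_mul_of_nonneg_left (hW t ht) (mul_pos hl (Real.exp_pos (-lam * t))).le
    linarith

lemma expMean_const {lam : ℝ} (hl : 0 < lam) (c : ℝ) : expMean lam (fun _ => c) = c := by
  simp only [expMean]
  rw [integral_mul_const, integral_expDensity_Ioi hl]
  simp

lemma expIntegrable_const (c : ℝ) : ExpIntegrable fun _ => c := fun _ hl =>
  (integrableOn_expDensity hl 0).mul_const c

lemma expMean_mono {lam : ℝ} (hl : 0 < lam) {V W : ℝ → ℝ} (hV : ExpIntegrable V)
    (hW : ExpIntegrable W) (h : ∀ t, 0 < t → V t ≤ W t) : expMean lam V ≤ expMean lam W :=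
  setIntegral_mono_on (hV lam hl) (hW lam hl) measurableSet_Ioi fun t ht =>
    mul_le_mul_of_nonneg_left (h t ht) (mul_pos hl (Real.exp_pos _)).le

lemma expMean_lt {lam : ℝ} (hl : 0 < lam) {V W : ℝ → ℝ} (hV : ExpIntegrable V)
    (hW : ExpIntegrable W) (h : ∀ t, 0 < t → V t ≤ W t) {t₀ : ℝ} (ht₀ : 0 ≤ t₀)
    (h' : ∀ t, t₀ < t → V t < W t) : expMean lam V < expMean lam W := by
  have hd : ∀ t, 0 < lam * Real.exp (-lam * t) := fun t => mul_pos hl (Real.exp_pos _)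
  rw [← sub_pos]
  simp only [expMean]
  rw [← integral_sub (hW lam hl) (hV lam hl), setIntegral_pos_iff_support_of_nonneg_ae]
  · refine lt_of_lt_of_le ?_ (measure_mono (s := Ioi t₀) ?_)
    · simp
    · intro t ht
      refine ⟨?_, ht₀.trans_lt ht⟩
      rw [Function.mem_support, ← mul_sub]
      exact (mul_pos (hd t) (sub_pos.2 (h' t ht))).ne'
  · refine (ae_restrict_iff' measurableSet_Ioi).2 (Eventually.of_forall fun t ht => ?_)
    simp only [Pi.zero_apply, ← mul_sub]
    exact mul_nonneg (hd t).le (sub_nonneg.2 (h t ht))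
  · exact (hW lam hl).sub (hV lam hl)

/-- The mean of `W` stopped at `τ`. -/
lemma expMean_stopped {lam : ℝ} (hl : 0 < lam) {W : ℝ → ℝ} (hW : ExpIntegrable W) {τ : ℝ}
    (hτ : 0 ≤ τ) : expMean lam (fun t => W (min t τ)) =
      (∫ t in Ioc 0 τ, lam * Real.exp (-lam * t) * W t) + Real.exp (-lam * τ) * W τ := by
  have e1 : EqOn (fun t => lam * Real.exp (-lam * t) * W (min t τ))
      (fun t => lam * Real.exp (-lam * t) * W t) (Ioc 0 τ) := fun t ht => by
    simp only [min_eq_left ht.2]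
  have e2 : EqOn (fun t => lam * Real.exp (-lam * t) * W (min t τ))
      (fun t => lam * Real.exp (-lam * t) * W τ) (Ioi τ) := fun t ht => by
    simp only [min_eq_right (le_of_lt (mem_Ioi.1 ht))]
  simp only [expMean]
  rw [← Ioc_union_Ioi_eq_Ioi hτ, setIntegral_union (Ioc_disjoint_Ioi le_rfl) measurableSet_Ioi,
    setIntegral_congr_fun measurableSet_Ioc e1, setIntegral_congr_fun measurableSet_Ioi e2,
    integral_mul_const, integral_expDensity_Ioi hl]
  · exact IntegrableOn.congr_fun ((hW lam hl).mono_set Ioc_subset_Ioi_self) e1.symm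
      measurableSet_Ioc
  · exact IntegrableOn.congr_fun ((integrableOn_expDensity hl τ).mul_const _) e2.symm
      measurableSet_Ioi

/-- The minimum of two independent exponential times of rates `lam` and `mu` is exponential of
rate `lam + mu`. -/
lemma expMean_expMean_stopped {lam mu : ℝ} (hl : 0 < lam) (hm : 0 < mu) {W : ℝ → ℝ}
    (hW : ExpIntegrable W) :
    expMean mu (fun τ => expMean lam fun t => W (min t τ)) = expMean (lam + mu) W ∧
    IntegrableOn (fun τ => mu * Real.exp (-mu * τ) * expMean lam fun t => W (min t τ)) (Ioi 0) := by
  have hs : 0 < lam + mu := add_pos hl hm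
  set g : ℝ → ℝ := fun t => lam * Real.exp (-lam * t) * W t
  set h : ℝ → ℝ := fun τ => mu * Real.exp (-mu * τ)
  set μ₀ : Measure ℝ := volume.restrict (Ioi 0)
  have hg : Integrable g μ₀ := hW lam hl
  have hh : Integrable h μ₀ := integrableOn_expDensity hm 0
  set S : Set (ℝ × ℝ) := {p | p.2 ≤ p.1}
  have hS : MeasurableSet S := measurableSet_le measurable_snd measurable_fst
  have hF : Integrable (S.indicator fun p => h p.1 * g p.2) (μ₀.prod μ₀) :=
    (hh.mul_prod hg).indicator hS
  have key : ∀ τ, 0 < τ → mu * Real.exp (-mu * τ) * expMean lam (fun t => W (min t τ)) =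
      (∫ t, S.indicator (fun p => h p.1 * g p.2) (τ, t) ∂μ₀) +
        mu / (lam + mu) * ((lam + mu) * Real.exp (-(lam + mu) * τ) * W τ) := by
    intro τ hτ
    rw [expMean_stopped hl hW hτ.le, mul_add]
    congr 1
    · have : (fun t => S.indicator (fun p => h p.1 * g p.2) (τ, t)) =
          (Iic τ).indicator fun t => h τ * g t := by
        funext t; simp [S, indicator]
      rw [this, integral_indicator measurableSet_Iic, Measure.restrict_restrict measurableSet_Iic,
        Iic_inter_Ioi, integral_const_mul]
    · rw [show -(lam + mu) * τ = -mu * τ + -lam * τ by ring, Real.exp_add]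
      field_simp
  have i1 := hF.integral_prod_left
  have i2 : Integrable (fun τ => mu / (lam + mu) *
    ((lam + mu) * Real.exp (-(lam + mu) * τ) * W τ)) μ₀ := (hW _ hs).const_mul _
  refine ⟨?_, IntegrableOn.congr_fun (i1.add i2) (fun τ hτ => (key τ hτ).symm)
    measurableSet_Ioi⟩
  rw [expMean, setIntegral_congr_fun measurableSet_Ioi fun τ hτ => key τ hτ,
    integral_add i1 i2, integral_integral_swap
      (f := fun τ t => S.indicator (fun p => h p.1 * g p.2) (τ, t)) hF, integral_const_mul]
  have sw : ∀ t ∈ Ioi (0 : ℝ), (∫ τ, S.indicator (fun p => h p.1 * g p.2) (τ, t) ∂μ₀) =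
      lam / (lam + mu) * ((lam + mu) * Real.exp (-(lam + mu) * t) * W t) := by
    intro t ht
    have : (fun τ => S.indicator (fun p => h p.1 * g p.2) (τ, t)) =
        (Ici t).indicator fun τ => h τ * g t := by
      funext τ; simp [S, indicator]
    rw [this, integral_indicator measurableSet_Ici, Measure.restrict_restrict measurableSet_Ici,
      inter_eq_left.2 (show Ici t ⊆ Ioi 0 from Ici_subset_Ioi.2 ht),
      integral_Ici_eq_integral_Ioi, integral_mul_const, integral_expDensity_Ioi hm,
      show -(lam + mu) * t = -mu * t + -lam * t by ring, Real.exp_add]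
    simp only [g]
    field_simp
  rw [setIntegral_congr_fun measurableSet_Ioi sw, integral_const_mul, ← add_mul, ← add_div,
    div_self hs.ne', one_mul, expMean]

/-- A lower bound on the mean of a function that is at least `b` until `τ`, even at least `b + c`
between `s` and `τ`, and nonnegative afterwards. -/
lemma le_expMean_of_step {lam : ℝ} (hl : 0 < lam) {W : ℝ → ℝ} (hW : ExpIntegrable W)
    {b c s τ : ℝ} (hs : 0 ≤ s) (hsτ : s ≤ τ) (h1 : ∀ t, 0 < t → t ≤ s → b ≤ W t)
    (h2 : ∀ t, s < t → t < τ → b + c ≤ W t) (h3 : ∀ t, τ < t → 0 ≤ W t) :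
    b * (1 - Real.exp (-lam * τ)) + c * (Real.exp (-lam * s) - Real.exp (-lam * τ))
      ≤ expMean lam W := by
  have hd : ∀ t, 0 < lam * Real.exp (-lam * t) := fun t => mul_pos hl (Real.exp_pos _)
  have hi := hW lam hl
  have hi1 := hi.mono_set (Ioc_subset_Ioi_self : Ioc 0 s ⊆ Ioi 0)
  have hi2 := hi.mono_set (Ioi_subset_Ioi hs)
  have hi3 := hi2.mono_set (Ioc_subset_Ioi_self : Ioc s τ ⊆ Ioi s)
  have hi4 := hi2.mono_set (Ioi_subset_Ioi hsτ)
  rw [expMean, ← Ioc_union_Ioi_eq_Ioi hs, setIntegral_union (Ioc_disjoint_Ioi le_rfl)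
    measurableSet_Ioi hi1 hi2, ← Ioc_union_Ioi_eq_Ioi hsτ,
    setIntegral_union (Ioc_disjoint_Ioi le_rfl) measurableSet_Ioi hi3 hi4]
  have b1 : (∫ t in Ioc 0 s, lam * Real.exp (-lam * t) * b) ≤
      ∫ t in Ioc 0 s, lam * Real.exp (-lam * t) * W t :=
    setIntegral_mono_on (((integrableOn_expDensity hl 0).mono_set Ioc_subset_Ioi_self).mul_const b)
      hi1 measurableSet_Ioc fun t ht => mul_le_mul_of_nonneg_left (h1 t ht.1 ht.2) (hd t).le
  have b2 : (∫ t in Ioo s τ, lam * Real.exp (-lam * t) * (b + c)) ≤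
      ∫ t in Ioo s τ, lam * Real.exp (-lam * t) * W t :=
    setIntegral_mono_on (((integrableOn_expDensity hl s).mono_set
      (Ioo_subset_Ioi_self)).mul_const _)
      (hi3.mono_set Ioo_subset_Ioc_self) measurableSet_Ioo
      fun t ht => mul_le_mul_of_nonneg_left (h2 t ht.1 ht.2) (hd t).le
  have b3 : 0 ≤ ∫ t in Ioi τ, lam * Real.exp (-lam * t) * W t :=
    setIntegral_nonneg measurableSet_Ioi fun t ht => mul_nonneg (hd t).le (h3 t ht)
  rw [← integral_Ioc_eq_integral_Ioo, ← integral_Ioc_eq_integral_Ioo, integral_mul_const,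
    integral_expDensity_Ioc hl hsτ] at b2
  rw [integral_mul_const, integral_expDensity_Ioc hl hs] at b1
  simp only [mul_zero, Real.exp_zero] at b1
  linarith

/-- An upper bound on the mean of a stopped function that is at most `b` before it is stopped. -/
lemma expMean_stopped_le {lam : ℝ} (hl : 0 < lam) {W : ℝ → ℝ} (hW : ExpIntegrable W) {b τ : ℝ}
    (hτ : 0 ≤ τ) (h : ∀ t, 0 < t → t ≤ τ → W t ≤ b) :
    expMean lam (fun t => W (min t τ)) ≤
      (1 - Real.exp (-lam * τ)) * b + Real.exp (-lam * τ) * W τ := by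
  rw [expMean_stopped hl hW hτ]
  have b1 : (∫ t in Ioc 0 τ, lam * Real.exp (-lam * t) * W t) ≤
      ∫ t in Ioc 0 τ, lam * Real.exp (-lam * t) * b :=
    setIntegral_mono_on ((hW lam hl).mono_set Ioc_subset_Ioi_self)
      (((integrableOn_expDensity hl 0).mono_set Ioc_subset_Ioi_self).mul_const b)
      measurableSet_Ioc fun t ht => mul_le_mul_of_nonneg_left (h t ht.1 ht.2)
        (mul_pos hl (Real.exp_pos _)).le
  rw [integral_mul_const, integral_expDensity_Ioc hl hτ] at b1
  simp only [mul_zero, Real.exp_zero] at b1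
  linarith

/-! ### Trajectories and their costs -/

variable {n m : ℕ} {P : ControlProblem n m}

lemma Standing.isCompact_closure (hP : P.Standing) : IsCompact (closure P.Ω) :=
  hP.isBounded.isCompact_closure

lemma Standing.continuousOn_f (hP : P.Standing) :
    ContinuousOn (fun p : _ × _ => P.f p.1 p.2) (closure P.Ω ×ˢ P.A) := by
  obtain ⟨L, hL⟩ := hP.lipschitz
  exact continuousOn_prod_of_continuousOn_lipschitzOnWith _ L hP.continuous hL

lemma Standing.exists_speed_bound (hP : P.Standing) :
    ∃ F : ℝ, 0 < F ∧ ∀ x ∈ closure P.Ω, ∀ a ∈ P.A, ‖P.f x a‖ ≤ F := by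
  obtain ⟨C, hC⟩ := (hP.isCompact_closure.prod hP.isCompact).exists_bound_of_continuousOn
    hP.continuousOn_f
  exact ⟨max C 1, by positivity, fun x hx a ha => (hC (x, a) ⟨hx, ha⟩).trans (le_max_left _ _)⟩

lemma Standing.measurable_f (hP : P.Standing) :
    Measurable fun p : closure P.Ω ×ˢ P.A => P.f p.1.1 p.1.2 :=
  (continuousOn_iff_continuous_domRestrict.1 hP.continuousOn_f).measurable

lemma Standing.measurable_K (hP : P.Standing) :
    Measurable fun p : closure P.Ω ×ˢ P.A => P.K p.1.1 p.1.2 :=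
  (lowerSemicontinuous_restrict_iff.2 hP.K_lsc).measurable

lemma Standing.measurable_q (hP : P.Standing) :
    Measurable fun p : closure P.Ω ×ˢ P.A => P.q p.1.1 :=
  (lowerSemicontinuous_restrict_iff.2 hP.q_lsc).measurable.comp
    (f := fun p : closure P.Ω ×ˢ P.A => (⟨p.1.1, p.2.1⟩ : closure P.Ω))
    ((measurable_fst.comp measurable_subtype_coe).subtype_mk)

lemma Standing.nonneg_cost (hP : P.Standing) {x} (hx : x ∈ closure P.Ω) {a} (ha : a ∈ P.A) :
    0 ≤ P.K x a := hP.K_nonneg x hx a ha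

namespace IsTrajectory

variable {x : EuclideanSpace ℝ (Fin n)} {a : ℝ → EuclideanSpace ℝ (Fin m)}
  {y : ℝ → EuclideanSpace ℝ (Fin n)}

/-- Stopping a motion at the time `τ`, by using the control value `a₀` from then on, stops the
integral of any quantity that vanishes for this value. -/
lemma integral_stopped {γ : Type*} [NormedAddCommGroup γ] [NormedSpace ℝ γ]
    {g : EuclideanSpace ℝ (Fin n) → EuclideanSpace ℝ (Fin m) → γ}
    (hg : ∀ x ∈ closure P.Ω, g x P.a₀ = 0) (h : ∀ t, 0 ≤ t → y t ∈ closure P.Ω)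
    {τ t : ℝ} (hτ : 0 ≤ τ) (ht : 0 ≤ t) :
    ∫ s in (0 : ℝ)..t, g (y (min s τ)) (if s ≤ τ then a s else P.a₀) =
      ∫ s in (0 : ℝ)..min t τ, g (y s) (a s) := by
  have hm := le_min ht hτ
  have e1 : EqOn (fun s => g (y (min s τ)) (if s ≤ τ then a s else P.a₀))
      ((Iic τ).indicator fun s => g (y s) (a s)) (Ioc 0 t) := fun s hs => by
    by_cases hsτ : s ≤ τ
    · simp [hsτ]
    · simp only [hsτ, if_false, mem_Iic, not_false_iff, indicator_of_notMem]
      exact hg _ (h _ (le_min hs.1.le hτ))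
  rw [intervalIntegral.integral_of_le hm, intervalIntegral.integral_of_le ht,
    setIntegral_congr_fun measurableSet_Ioc e1, integral_indicator measurableSet_Iic,
    Measure.restrict_restrict measurableSet_Iic]
  congr 2
  ext s
  simp only [mem_inter_iff, mem_Iic, mem_Ioc, le_min_iff]
  tauto

lemma initial (h : P.IsTrajectory x a y) : y 0 = x := by
  simpa using h.eq_integral 0 le_rfl

lemma mem_closure_initial (h : P.IsTrajectory x a y) : x ∈ closure P.Ω :=
  h.initial ▸ h.mem_closure 0 le_rfl

/-- A function of state and control that is measurable where it is meaningful is measurable along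
a controlled trajectory. -/
lemma aestronglyMeasurable_comp {γ : Type*} [NormedAddCommGroup γ] [MeasurableSpace γ]
    [BorelSpace γ] [SecondCountableTopology γ] (h : P.IsTrajectory x a y)
    {g : EuclideanSpace ℝ (Fin n) → EuclideanSpace ℝ (Fin m) → γ}
    (hg : Measurable fun p : closure P.Ω ×ˢ P.A => g p.1.1 p.1.2) :
    AEStronglyMeasurable (fun t => g (y t) (a t)) (volume.restrict (Ici 0)) := by
  -- the trajectory is extended to negative times by its initial value
  have hy : Continuous fun t : ℝ => y (max 0 t) :=
    h.continuousOn.comp_continuous (by fun_prop) fun t => mem_Ici.2 (le_max_left _ _)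
  have hφ : Measurable fun t : ℝ => (⟨(y (max 0 t), a t),
      h.mem_closure _ (le_max_left _ _), h.mem_controls t⟩ : closure P.Ω ×ˢ P.A) :=
    (hy.measurable.prodMk h.measurable).subtype_mk
  refine AEStronglyMeasurable.congr (hg.comp hφ).aestronglyMeasurable ?_
  refine (ae_restrict_iff' measurableSet_Ici).2 (Eventually.of_forall fun t ht => ?_)
  simp [max_eq_right (mem_Ici.1 ht)]

lemma intervalIntegrable_comp {γ : Type*} [NormedAddCommGroup γ] [MeasurableSpace γ]
    [BorelSpace γ] [SecondCountableTopology γ] (h : P.IsTrajectory x a y)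
    {g : EuclideanSpace ℝ (Fin n) → EuclideanSpace ℝ (Fin m) → γ}
    (hg : Measurable fun p : closure P.Ω ×ˢ P.A => g p.1.1 p.1.2) {C : ℝ}
    (hC : ∀ x ∈ closure P.Ω, ∀ a ∈ P.A, ‖g x a‖ ≤ C) {s t : ℝ} (hs : 0 ≤ s) (ht : 0 ≤ t) :
    IntervalIntegrable (fun t => g (y t) (a t)) volume s t := by
  have hsub : uIoc s t ⊆ Ici 0 := fun r hr => (le_min hs ht).trans hr.1.le
  rw [intervalIntegrable_iff]
  refine IntegrableOn.of_bound (by simp)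
    ((h.aestronglyMeasurable_comp hg).mono_measure (Measure.restrict_mono hsub le_rfl)) C ?_
  exact (ae_restrict_iff' measurableSet_uIoc).2 (Eventually.of_forall fun r hr =>
    hC _ (h.mem_closure r (hsub hr)) _ (h.mem_controls r))

lemma intervalIntegrable_f (hP : P.Standing) (h : P.IsTrajectory x a y)
    {s t : ℝ} (hs : 0 ≤ s) (ht : 0 ≤ t) :
    IntervalIntegrable (fun t => P.f (y t) (a t)) volume s t := by
  obtain ⟨F, -, hF⟩ := hP.exists_speed_bound
  exact h.intervalIntegrable_comp hP.measurable_f hF hs ht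

lemma intervalIntegrable_K (hP : P.Standing) (h : P.IsTrajectory x a y)
    {s t : ℝ} (hs : 0 ≤ s) (ht : 0 ≤ t) :
    IntervalIntegrable (fun t => P.K (y t) (a t)) volume s t := by
  obtain ⟨C, hC⟩ := hP.K_bdd
  exact h.intervalIntegrable_comp hP.measurable_K (C := C) (fun x hx a ha => by
    rw [Real.norm_of_nonneg (hP.nonneg_cost hx ha)]; exact hC x hx a ha) hs ht

lemma sub_eq_integral (hP : P.Standing) (h : P.IsTrajectory x a y)
    {s t : ℝ} (hs : 0 ≤ s) (ht : 0 ≤ t) :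
    y t - y s = ∫ r in s..t, P.f (y r) (a r) := by
  rw [h.eq_integral t ht, h.eq_integral s hs, ← intervalIntegral.integral_interval_sub_left
    (h.intervalIntegrable_f hP le_rfl ht) (h.intervalIntegrable_f hP le_rfl hs)]
  abel

lemma norm_sub_le (hP : P.Standing) (h : P.IsTrajectory x a y) {F : ℝ}
    (hF : ∀ x ∈ closure P.Ω, ∀ a ∈ P.A, ‖P.f x a‖ ≤ F) {s t : ℝ} (hs : 0 ≤ s) (hst : s ≤ t) :
    ‖y t - y s‖ ≤ F * (t - s) := by
  rw [h.sub_eq_integral hP hs (hs.trans hst), ← abs_of_nonneg (sub_nonneg.2 hst)]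
  refine intervalIntegral.norm_integral_le_of_norm_le_const fun r hr => ?_
  exact hF _ (h.mem_closure r ((le_min hs (hs.trans hst)).trans hr.1.le)) _ (h.mem_controls r)

lemma integral_K_nonneg (hP : P.Standing) (h : P.IsTrajectory x a y)
    {s t : ℝ} (hs : 0 ≤ s) (hst : s ≤ t) :
    0 ≤ ∫ r in s..t, P.K (y r) (a r) :=
  intervalIntegral.integral_nonneg hst fun r hr =>
    hP.nonneg_cost (h.mem_closure r (hs.trans hr.1)) (h.mem_controls r)

lemma omega_sub (hP : P.Standing) (h : P.IsTrajectory x a y) {s t : ℝ} (hs : 0 ≤ s) (ht : 0 ≤ t) :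
    P.omega a y t - P.omega a y s =
      (∫ r in s..t, P.K (y r) (a r)) + (P.q (y t) - P.q (y s)) := by
  rw [omega, omega, ← intervalIntegral.integral_interval_sub_left
    (h.intervalIntegrable_K hP le_rfl ht) (h.intervalIntegrable_K hP le_rfl hs)]
  ring

lemma omega_zero (h : P.IsTrajectory x a y) : P.omega a y 0 = P.q x := by
  simp [omega, h.initial]

lemma q_le_omega (hP : P.Standing) (h : P.IsTrajectory x a y) {t : ℝ} (ht : 0 ≤ t) :
    P.q (y t) ≤ P.omega a y t :=
  le_add_of_nonneg_left (h.integral_K_nonneg hP le_rfl ht)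

lemma omega_nonneg (hP : P.Standing) (h : P.IsTrajectory x a y) {t : ℝ} (ht : 0 ≤ t) :
    0 ≤ P.omega a y t :=
  (hP.q_nonneg _ (h.mem_closure t ht)).trans (h.q_le_omega hP ht)

lemma integral_K_le (hP : P.Standing) (h : P.IsTrajectory x a y) {K₂ : ℝ}
    (hK : ∀ x ∈ closure P.Ω, ∀ a ∈ P.A, P.K x a ≤ K₂) {t : ℝ} (ht : 0 ≤ t) :
    ∫ r in (0 : ℝ)..t, P.K (y r) (a r) ≤ K₂ * t := by
  have := intervalIntegral.integral_mono_on ht (h.intervalIntegrable_K hP le_rfl ht)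
    (intervalIntegrable_const (c := K₂)) fun r hr =>
      hK _ (h.mem_closure r hr.1) _ (h.mem_controls r)
  simpa [mul_comm] using this

lemma omega_le (hP : P.Standing) (h : P.IsTrajectory x a y)
    {q₂ K₂ : ℝ} (hq : ∀ x ∈ closure P.Ω, P.q x ≤ q₂)
    (hK : ∀ x ∈ closure P.Ω, ∀ a ∈ P.A, P.K x a ≤ K₂) {t : ℝ} (ht : 0 ≤ t) :
    P.omega a y t ≤ q₂ + K₂ * t := by
  have := h.integral_K_le hP hK ht
  have := hq _ (h.mem_closure t ht)
  simp only [omega]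
  linarith

lemma continuousOn_integral_K (hP : P.Standing) (h : P.IsTrajectory x a y) (T : ℝ) :
    ContinuousOn (fun t => ∫ r in (0 : ℝ)..t, P.K (y r) (a r)) (Icc 0 T) := by
  rcases lt_or_ge T 0 with hT | hT
  · simp [Icc_eq_empty_of_lt hT]
  · rw [← uIcc_of_le hT]
    exact intervalIntegral.continuousOn_primitive_interval
      ((h.intervalIntegrable_K hP le_rfl hT).def'.mono_set_ae
        (by rw [uIoc_of_le hT, uIcc_of_le hT]; exact Ioc_ae_eq_Icc.symm.le))

lemma lowerSemicontinuousOn_omega (hP : P.Standing) (h : P.IsTrajectory x a y) (T : ℝ) :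
    LowerSemicontinuousOn (P.omega a y) (Icc 0 T) :=
  (h.continuousOn_integral_K hP T).lowerSemicontinuousOn.add
    (hP.q_lsc.comp (h.continuousOn.mono Icc_subset_Ici_self) fun t ht => h.mem_closure t ht.1)

lemma expIntegrable_omega (hP : P.Standing) (h : P.IsTrajectory x a y) :
    ExpIntegrable (P.omega a y) := by
  obtain ⟨q₂, hq⟩ := hP.q_bdd
  obtain ⟨K₂, hK⟩ := hP.K_bdd
  refine expIntegrable_of_linear_growth (b := q₂) (c := K₂) ?_ fun t ht => ?_
  · refine AEStronglyMeasurable.add ?_ ?_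
    · refine ContinuousOn.aestronglyMeasurable (fun t ht => ?_) measurableSet_Ioi
      refine ((h.continuousOn_integral_K hP (t + 1)).continuousAt
        (Icc_mem_nhds ht (lt_add_one t))).continuousWithinAt
    · exact (h.aestronglyMeasurable_comp (g := fun x _ => P.q x) hP.measurable_q).mono_measure
        (Measure.restrict_mono Ioi_subset_Ici_self le_rfl)
  · rw [abs_of_nonneg (h.omega_nonneg hP ht.le)]
    exact h.omega_le hP hq hK ht.le

/-- Any admissible control may be stopped at any time `τ`, by using the value `a₀` from then on. -/
lemma stopped (hP : P.Standing) (h : P.IsTrajectory x a y) {τ : ℝ} (hτ : 0 ≤ τ) :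
    P.IsTrajectory x (fun t => if t ≤ τ then a t else P.a₀) (fun t => y (min t τ)) where
  measurable := Measurable.ite measurableSet_Iic h.measurable measurable_const
  mem_controls t := by
    split_ifs
    exacts [h.mem_controls t, hP.mem]
  continuousOn := h.continuousOn.comp (by fun_prop) fun t ht => le_min ht hτ
  mem_closure t ht := h.mem_closure _ (le_min ht hτ)
  eq_integral t ht := by
    rw [integral_stopped hP.f_motionless h.mem_closure hτ ht, h.eq_integral _ (le_min ht hτ)]

lemma omega_stopped (hP : P.Standing) (h : P.IsTrajectory x a y) {τ t : ℝ} (hτ : 0 ≤ τ)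
    (ht : 0 ≤ t) :
    P.omega (fun t => if t ≤ τ then a t else P.a₀) (fun t => y (min t τ)) t =
      P.omega a y (min t τ) := by
  simp only [omega, integral_stopped hP.K_motionless h.mem_closure hτ ht]

lemma expIntegrable_stopped (hP : P.Standing) (h : P.IsTrajectory x a y) {τ : ℝ} (hτ : 0 ≤ τ) :
    ExpIntegrable fun t => P.omega a y (min t τ) := fun lam hl =>
  ((h.stopped hP hτ).expIntegrable_omega hP lam hl).congr_fun (fun t ht => by
    simp only [h.omega_stopped hP hτ (mem_Ioi.1 ht).le]) measurableSet_Ioi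

lemma expectedCost_stopped (hP : P.Standing) (h : P.IsTrajectory x a y) {τ : ℝ} (hτ : 0 ≤ τ)
    (lam : ℝ) : P.expectedCost lam (fun t => if t ≤ τ then a t else P.a₀) (fun t => y (min t τ)) =
      expMean lam fun t => P.omega a y (min t τ) :=
  setIntegral_congr_fun measurableSet_Ioi fun t ht => by
    simp only [h.omega_stopped hP hτ (mem_Ioi.1 ht).le]

/-- A trajectory is at rest from the time on at which its control value is `a₀`. -/
lemma eq_of_motionless (hP : P.Standing) (h : P.IsTrajectory x a y) {T t : ℝ} (hT : 0 ≤ T)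
    (hTt : T ≤ t) (ha : ∀ s, T ≤ s → a s = P.a₀) : y t = y T := by
  rw [← sub_eq_zero, h.sub_eq_integral hP hT (hT.trans hTt),
    intervalIntegral.integral_congr (g := fun _ => 0) fun s hs => ?_]
  · simp
  · rw [uIcc_of_le hTt] at hs
    dsimp only
    rw [ha s hs.1, hP.f_motionless _ (h.mem_closure s (hT.trans hs.1))]

lemma omega_eq_of_motionless (hP : P.Standing) (h : P.IsTrajectory x a y) {T t : ℝ} (hT : 0 ≤ T)
    (hTt : T ≤ t) (ha : ∀ s, T ≤ s → a s = P.a₀) : P.omega a y t = P.omega a y T := by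
  have := h.omega_sub hP hT (hT.trans hTt)
  rw [h.eq_of_motionless hP hT hTt ha,
    intervalIntegral.integral_congr (g := fun _ => 0) fun s hs => ?_] at this
  · simpa [sub_eq_zero] using this
  · rw [uIcc_of_le hTt] at hs
    dsimp only
    rw [ha s hs.1, hP.K_motionless _ (h.mem_closure s (hT.trans hs.1))]

end IsTrajectory

/-- The control `a₀` is admissible everywhere. -/
lemma Standing.isTrajectory_const (hP : P.Standing) {x : EuclideanSpace ℝ (Fin n)}
    (hx : x ∈ closure P.Ω) : P.IsTrajectory x (fun _ => P.a₀) (fun _ => x) where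
  measurable := measurable_const
  mem_controls _ := hP.mem
  continuousOn := continuousOn_const
  mem_closure _ _ := hx
  eq_integral t _ := by simp [hP.f_motionless x hx]

/-! ### The value functions -/

section Value

variable {x : EuclideanSpace ℝ (Fin n)} {a : ℝ → EuclideanSpace ℝ (Fin m)}
  {y : ℝ → EuclideanSpace ℝ (Fin n)} {lam : ℝ}

lemma Standing.value_zero_le_omega (hP : P.Standing) (h : P.IsTrajectory x a y) {T : ℝ}
    (hT : 0 ≤ T) : P.value 0 x ≤ P.omega a y T := by
  rw [value, if_pos rfl]
  refine csInf_le ⟨0, ?_⟩ ⟨a, y, T, h, hT, rfl⟩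
  rintro _ ⟨a, y, T, h, hT, rfl⟩
  exact h.omega_nonneg hP hT

lemma Standing.value_le_expMean (hP : P.Standing) (hl : 0 < lam) (h : P.IsTrajectory x a y) :
    P.value lam x ≤ expMean lam (P.omega a y) := by
  rw [value, if_neg hl.ne']
  refine csInf_le ⟨0, ?_⟩ ⟨a, y, h, rfl⟩
  rintro _ ⟨a, y, h, rfl⟩
  exact setIntegral_nonneg measurableSet_Ioi fun t ht =>
    mul_nonneg (mul_pos hl (Real.exp_pos _)).le (h.omega_nonneg hP (mem_Ioi.1 ht).le)

lemma Standing.value_le_expMean_stopped (hP : P.Standing) (hl : 0 < lam) (h : P.IsTrajectory x a y)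
    {τ : ℝ} (hτ : 0 ≤ τ) : P.value lam x ≤ expMean lam fun t => P.omega a y (min t τ) := by
  rw [← h.expectedCost_stopped hP hτ]
  exact hP.value_le_expMean hl (h.stopped hP hτ)

lemma Standing.le_value (hP : P.Standing) (hl : 0 < lam) (hx : x ∈ closure P.Ω) {c : ℝ}
    (hc : ∀ a y, P.IsTrajectory x a y → c ≤ expMean lam (P.omega a y)) : c ≤ P.value lam x := by
  rw [value, if_neg hl.ne']
  refine le_csInf ⟨_, _, _, hP.isTrajectory_const hx, rfl⟩ ?_
  rintro _ ⟨a, y, h, rfl⟩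
  exact hc a y h

lemma Standing.exists_omega_lt (hP : P.Standing) (hx : x ∈ closure P.Ω) {c : ℝ}
    (hc : P.value 0 x < c) : ∃ a y T, P.IsTrajectory x a y ∧ 0 ≤ T ∧ P.omega a y T < c := by
  rw [value, if_pos rfl] at hc
  obtain ⟨_, ⟨a, y, T, h, hT, rfl⟩, hlt⟩ := exists_lt_of_csInf_lt (by
    exact ⟨_, _, _, 0, hP.isTrajectory_const hx, le_rfl, rfl⟩) hc
  exact ⟨a, y, T, h, hT, hlt⟩

lemma Standing.value_le_q (hP : P.Standing) (hl : 0 ≤ lam) (hx : x ∈ closure P.Ω) :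
    P.value lam x ≤ P.q x := by
  have h := hP.isTrajectory_const hx
  rcases hl.eq_or_lt with rfl | hl
  · exact (hP.value_zero_le_omega h le_rfl).trans_eq h.omega_zero
  · refine (hP.value_le_expMean hl h).trans_eq ?_
    have e : P.omega (fun _ => P.a₀) (fun _ => x) = fun _ => P.q x := by
      funext t; simp [omega, hP.K_motionless x hx]
    rw [e, expMean_const hl]

lemma Standing.value_zero_le (hP : P.Standing) (hl : 0 < lam) (hx : x ∈ closure P.Ω) :
    P.value 0 x ≤ P.value lam x :=
  hP.le_value hl hx fun _ _ h => (expMean_const hl _).symm.trans_le <|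
    expMean_mono hl (expIntegrable_const _) (h.expIntegrable_omega hP) fun _ ht =>
      hP.value_zero_le_omega h ht.le

/-- Stopping a control at an exponential time of rate `lam₂ - lam₁` turns its expected cost for
the rate `lam₁` into its expected cost for the rate `lam₂`. -/
lemma Standing.value_mono (hP : P.Standing) {lam₁ lam₂ : ℝ} (h₁ : 0 ≤ lam₁) (h₂ : lam₁ ≤ lam₂)
    (hx : x ∈ closure P.Ω) : P.value lam₁ x ≤ P.value lam₂ x := by
  rcases h₂.eq_or_lt with rfl | h₂
  · exact le_rfl
  rcases h₁.eq_or_lt with rfl | h₁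
  · exact hP.value_zero_le h₂ hx
  refine hP.le_value (h₁.trans h₂) hx fun a y h => ?_
  have hm : 0 < lam₂ - lam₁ := sub_pos.2 h₂
  obtain ⟨e, hi⟩ := expMean_expMean_stopped h₁ hm (h.expIntegrable_omega hP)
  rw [add_sub_cancel] at e
  rw [← e]
  refine (expMean_const hm _).symm.trans_le ?_
  exact setIntegral_mono_on (expIntegrable_const _ _ hm) hi measurableSet_Ioi fun t ht =>
    mul_le_mul_of_nonneg_left (hP.value_le_expMean_stopped h₁ h (mem_Ioi.1 ht).le)
      (mul_pos hm (Real.exp_pos _)).le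

/-- For large rates the process is terminated before it has moved to a point at which the lower
semicontinuous `q` is much smaller. -/
lemma Standing.tendsto_value_atTop (hP : P.Standing) (hx : x ∈ closure P.Ω) :
    Tendsto (fun lam => P.value lam x) atTop (𝓝 (P.q x)) := by
  obtain ⟨F, hF0, hF⟩ := hP.exists_speed_bound
  refine tendsto_order.2 ⟨fun c hc => ?_, fun c hc => ?_⟩
  · obtain ⟨c', hcc', hc'⟩ := exists_between hc
    obtain ⟨r, hr, hball⟩ := Metric.mem_nhdsWithin_iff.1 (hP.q_lsc x hx c' hc')
    have hτ : 0 < r / F := div_pos hr hF0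
    have hlim : Tendsto (fun lam : ℝ => c' * (1 - Real.exp (-lam * (r / F)))) atTop (𝓝 c') := by
      have h0 : Tendsto (fun lam : ℝ => Real.exp (-lam * (r / F))) atTop (𝓝 0) :=
        Real.tendsto_exp_atBot.comp (tendsto_neg_atTop_atBot.atBot_mul_const hτ)
      simpa using (h0.const_sub 1).const_mul c'
    filter_upwards [hlim.eventually (lt_mem_nhds hcc'), eventually_gt_atTop 0] with lam hlt hl
    refine hlt.trans_le (hP.le_value hl hx fun a y h => ?_)
    have hstep : ∀ t, 0 < t → t < r / F → c' ≤ P.omega a y t := fun t ht htr => by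
      refine le_trans (le_of_lt (hball ⟨?_, h.mem_closure t ht.le⟩)) (h.q_le_omega hP ht.le)
      have := h.norm_sub_le hP hF le_rfl ht.le
      rw [h.initial, sub_zero] at this
      rw [mem_ball_iff_norm]
      refine this.trans_lt ?_
      rwa [lt_div_iff₀' hF0] at htr
    have := le_expMean_of_step hl (h.expIntegrable_omega hP) (b := c') (c := 0) (s := 0) le_rfl
      hτ.le (fun t h1 h2 => absurd h1 (not_lt.2 h2))
      (fun t ht htr => by simpa using hstep t ht htr)
      (fun t ht => h.omega_nonneg hP (hτ.trans ht).le)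
    simpa using this
  · filter_upwards [eventually_ge_atTop 0] with lam hl
    exact (hP.value_le_q hl hx).trans_lt hc

/-- A control that is stopped at a fixed time has, for small rates, nearly the cost that it has if
the process is not terminated. -/
lemma Standing.tendsto_value_zero (hP : P.Standing) (hx : x ∈ closure P.Ω) :
    Tendsto (fun lam => P.value lam x) (𝓝[>] 0) (𝓝 (P.value 0 x)) := by
  refine tendsto_order.2 ⟨fun c hc => ?_, fun c hc => ?_⟩
  · filter_upwards [self_mem_nhdsWithin] with lam hl
    exact hc.trans_le (hP.value_zero_le hl hx)
  · obtain ⟨a, y, T, h, hT, hlt⟩ := hP.exists_omega_lt hx hc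
    obtain ⟨q₂, hq⟩ := hP.q_bdd
    obtain ⟨K₂, hK⟩ := hP.K_bdd
    have hK₂ : 0 ≤ K₂ := (hP.nonneg_cost hx hP.mem).trans (hK x hx _ hP.mem)
    have hlim : Tendsto (fun lam : ℝ => (1 - Real.exp (-lam * T)) * (q₂ + K₂ * T) +
        Real.exp (-lam * T) * P.omega a y T) (𝓝[>] 0) (𝓝 (P.omega a y T)) := by
      have : Continuous fun lam : ℝ => (1 - Real.exp (-lam * T)) * (q₂ + K₂ * T) +
        Real.exp (-lam * T) * P.omega a y T := by fun_prop
      simpa using (this.tendsto 0).mono_left nhdsWithin_le_nhds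
    filter_upwards [hlim.eventually (gt_mem_nhds hlt), self_mem_nhdsWithin] with lam hlam hl
    refine lt_of_le_of_lt ((hP.value_le_expMean_stopped hl h hT).trans
      (expMean_stopped_le hl (h.expIntegrable_omega hP) hT fun t ht htT => ?_)) hlam
    exact (h.omega_le hP hq hK ht.le).trans (by gcongr)

lemma Standing.motionless_mono (hP : P.Standing) {lam₁ lam₂ : ℝ} (h₁ : 0 ≤ lam₁)
    (h₂ : lam₁ ≤ lam₂) : P.motionless lam₁ ⊆ P.motionless lam₂ := fun _ hx =>
  ⟨hx.1, (hP.value_le_q (h₁.trans h₂) hx.1).antisymm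
    (hx.2.symm.trans_le (hP.value_mono h₁ h₂ hx.1))⟩

end Value

/-! ### The cost along an optimal trajectory -/

section Optimal

variable {x : EuclideanSpace ℝ (Fin n)} {a : ℝ → EuclideanSpace ℝ (Fin m)}
  {y : ℝ → EuclideanSpace ℝ (Fin n)} {lam t₀ t : ℝ}

/-- If the cost of stopping were smaller at some earlier time, then stopping at the time at which
it is least would be strictly better. -/
lemma IsOptimalEM.omega_le (hP : P.Standing) (hl : 0 ≤ lam) (h : P.IsOptimalEM lam x a y t₀)
    (ht : 0 ≤ t) (htt₀ : t ≤ t₀) : P.omega a y t₀ ≤ P.omega a y t := by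
  have hy := h.trajectory
  have ho := h.optimal
  rcases hl.eq_or_lt with rfl | hl
  · rw [if_pos rfl] at ho
    exact ho.trans_le (hP.value_zero_le_omega hy ht)
  rw [if_neg hl.ne'] at ho
  obtain ⟨t₁, ht₁, hmin⟩ := (hy.lowerSemicontinuousOn_omega hP t₀).exists_isMinOn
    ⟨0, left_mem_Icc.2 h.time_nonneg⟩ isCompact_Icc
  by_contra! hlt
  have hmin' : P.omega a y t₁ < P.omega a y t₀ := (hmin ⟨ht, htt₀⟩).trans_lt hlt
  have hrest : ∀ s, t₀ ≤ s → P.omega a y s = P.omega a y t₀ := fun s hs =>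
    hy.omega_eq_of_motionless hP h.time_nonneg hs h.motionless
  refine (hP.value_le_expMean_stopped hl hy ht₁.1).not_gt ?_
  rw [← ho]
  refine expMean_lt hl (hy.expIntegrable_stopped hP ht₁.1) (hy.expIntegrable_omega hP)
    (fun s hs => ?_) h.time_nonneg fun s hs => ?_
  · rcases le_total s t₁ with hst | hst
    · rw [min_eq_left hst]
    · rw [min_eq_right hst]
      rcases le_total s t₀ with hs0 | hs0
      · exact hmin ⟨hs.le, hs0⟩
      · rw [hrest s hs0]
        exact hmin'.le
  · rw [min_eq_right (ht₁.2.trans hs.le), hrest s hs.le]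
    exact hmin'

lemma IsOptimalEM.q_add_integral_le (hP : P.Standing) (hl : 0 ≤ lam)
    (h : P.IsOptimalEM lam x a y t₀) (ht : 0 ≤ t) (htt₀ : t ≤ t₀) :
    P.q (y t₀) + ∫ r in t..t₀, P.K (y r) (a r) ≤ P.q (y t) := by
  have h1 := h.omega_le hP hl ht htt₀
  have h2 := h.trajectory.omega_sub hP ht h.time_nonneg
  linarith

lemma exists_pos_le_of_infRunningCost_pos {S : Set (EuclideanSpace ℝ (Fin n))}
    (h : 0 < P.infRunningCost S) : ∃ c : ℝ, 0 < c ∧ ∀ x ∈ S, ∀ a ∈ P.A \ {P.a₀}, c ≤ P.K x a := by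
  obtain ⟨c, h0, hc⟩ := EReal.lt_iff_exists_real_btwn.1 h
  refine ⟨c, by exact_mod_cast h0, fun x hx a ha => ?_⟩
  exact_mod_cast hc.le.trans ((iInf₂_le x hx).trans (iInf₂_le a ha))

lemma IsTrajectory.integral_K_pos (hP : P.Standing) (h : P.IsTrajectory x a y)
    (hK : 0 < P.infRunningCost (closure P.Ω)) (ht : 0 ≤ t) (htt₀ : t ≤ t₀)
    (ha : ∀ s, t₀ ≤ s → a s = P.a₀)
    (hne : ¬ ∀ᵐ s ∂(volume.restrict (Ioi t)), a s = P.a₀) :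
    0 < ∫ r in t..t₀, P.K (y r) (a r) := by
  obtain ⟨c, hc0, hc⟩ := exists_pos_le_of_infRunningCost_pos hK
  refine (h.integral_K_nonneg hP ht htt₀).lt_of_ne fun h0 => hne ?_
  rw [eq_comm, intervalIntegral.integral_of_le htt₀, setIntegral_eq_zero_iff_of_nonneg_ae] at h0
  · rw [← Ioc_union_Ioi_eq_Ioi htt₀, ae_restrict_union_iff]
    constructor
    · filter_upwards [h0, ae_restrict_mem measurableSet_Ioc] with s hs hst
      by_contra hsa
      have := hc _ (h.mem_closure s (ht.trans hst.1.le)) (a s) ⟨h.mem_controls s, hsa⟩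
      simp only [Pi.zero_apply] at hs
      linarith
    · filter_upwards [ae_restrict_mem measurableSet_Ioi] with s hs using ha s (mem_Ioi.1 hs).le
  · filter_upwards [ae_restrict_mem measurableSet_Ioc] with s hst
    exact hP.nonneg_cost (h.mem_closure s (ht.trans hst.1.le)) (h.mem_controls s)
  · exact (h.intervalIntegrable_K hP ht (ht.trans htt₀)).1

end Optimal

variable {x : EuclideanSpace ℝ (Fin n)}
  {a : ℝ → EuclideanSpace ℝ (Fin m)} {y : ℝ → EuclideanSpace ℝ (Fin n)} {lam : ℝ}

/-! ### Motionless points are stationary for the directional derivatives -/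

lemma nonneg_coe_add_of_forall_le {k : ℝ} {D : EReal}
    (h : ∀ η : ℝ, 0 < η → ((-k - η : ℝ) : EReal) ≤ D) : 0 ≤ (k : EReal) + D := by
  induction D with
  | bot => exact absurd (h 1 one_pos) (not_le.2 (EReal.bot_lt_coe _))
  | top => simp
  | coe d =>
    norm_cast
    refine le_of_forall_pos_le_add fun η hη => ?_
    have := h η hη
    norm_cast at this
    linarith

lemma exists_pos_lt_of_coe_add_pos {k : ℝ} {D : EReal} (h : 0 < (k : EReal) + D) :
    ∃ δ : ℝ, 0 < δ ∧ ((δ - k : ℝ) : EReal) < D := by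
  induction D with
  | bot => simp at h
  | top => exact ⟨1, one_pos, EReal.coe_lt_top _⟩
  | coe d =>
    norm_cast at h
    refine ⟨(k + d) / 2, by linarith, ?_⟩
    norm_cast
    linarith

/-- From an interior point, any control value can be used for a short time. -/
lemma Standing.exists_isTrajectory_of_mem (hP : P.Standing) (hx : x ∈ P.Ω)
    {b : EuclideanSpace ℝ (Fin m)} (hb : b ∈ P.A) :
    ∃ τ > 0, ∃ y, P.IsTrajectory x (fun t => if t ≤ τ then b else P.a₀) y := by
  obtain ⟨F, hF0, hF⟩ := hP.exists_speed_bound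
  obtain ⟨L, hL⟩ := hP.lipschitz
  obtain ⟨r, hr, hball⟩ := Metric.nhds_basis_closedBall.mem_iff.1 (hP.isOpen.mem_nhds hx)
  have hcl : Metric.closedBall x r ⊆ closure P.Ω := hball.trans subset_closure
  have hτ : 0 < r / F := div_pos hr hF0
  let t₀ : Icc (0 : ℝ) (r / F) := ⟨0, left_mem_Icc.2 hτ.le⟩
  have hPL : IsPicardLindelof (fun _ z => P.f z b) t₀ x (.mk r hr.le) 0 (.mk F hF0.le) L := by
    refine .of_time_independent (fun z hz => hF z (hcl hz) b hb) ((hL b hb).mono hcl) ?_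
    simp only [t₀, sub_zero, sub_self, max_eq_left hτ.le, NNReal.coe_mk, NNReal.coe_zero]
    exact (mul_div_cancel₀ r hF0.ne').le
  obtain ⟨α, hα⟩ := ODE.FunSpace.exists_isFixedPt_next hPL (Metric.mem_closedBall_self le_rfl)
  have hmem : ∀ t, α.compProj t ∈ closure P.Ω := fun t =>
    hcl (α.compProj_mem_closedBall hPL.mul_max_le)
  refine ⟨r / F, hτ, fun t => α.compProj (min t (r / F)),
    Measurable.ite measurableSet_Iic measurable_const measurable_const, fun t => ?_,
    (α.continuous_compProj.comp (by fun_prop)).continuousOn, fun t _ => hmem _, fun t ht => ?_⟩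
  · split_ifs
    exacts [hb, hP.mem]
  · rw [IsTrajectory.integral_stopped (a := fun _ => b) hP.f_motionless (fun t _ => hmem t)
      hτ.le ht]
    have ht' : min t (r / F) ∈ Icc 0 (r / F) := ⟨le_min ht hτ.le, min_le_right _ _⟩
    conv_lhs => rw [ODE.FunSpace.compProj_of_mem ht', ← hα]
    rfl

lemma Standing.motionless_regular_subset (hP : P.Standing) (hl : 0 < lam) :
    P.motionless lam ∩ P.regularPoints ⊆ P.motionlessInf := by
  rintro x ⟨⟨hxc, hv⟩, hx, ⟨C, U, hU, hq⟩, hKc⟩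
  refine ⟨hxc, le_iInf₂ fun b hb => nonneg_coe_add_of_forall_le fun η hη => ?_⟩
  refine le_liminf_of_le (by isBoundedDefault) ?_
  refine Eventually.filter_mono (nhdsWithin_mono 0 (t := Ioi 0) fun t ht => ht.1) ?_
  obtain ⟨F, hF0, hF⟩ := hP.exists_speed_bound
  obtain ⟨L, hL⟩ := hP.lipschitz
  obtain ⟨K₂, hK₂⟩ := hP.K_bdd
  obtain ⟨τ, hτ, y, h⟩ := hP.exists_isTrajectory_of_mem hx hb.1
  obtain ⟨ρ, hρ, hball⟩ := Metric.nhds_basis_ball.mem_iff.1 (inter_mem hU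
    ((hKc b hb).eventually (gt_mem_nhds (lt_add_of_pos_right (P.K x b) (half_pos hη)))))
  -- the error terms of first order tend to zero
  have hlim : Tendsto (fun t : ℝ => C * (L * F * t) +
      (Real.exp (lam * t) - 1) * (K₂ + C * F)) (𝓝[>] 0) (𝓝 0) := by
    have : Continuous fun t : ℝ => C * (L * F * t) +
      (Real.exp (lam * t) - 1) * (K₂ + C * F) := by fun_prop
    simpa using (this.tendsto 0).mono_left nhdsWithin_le_nhds
  filter_upwards [hlim.eventually (gt_mem_nhds (half_pos hη)), self_mem_nhdsWithin,
    nhdsWithin_le_nhds (gt_mem_nhds hτ), nhdsWithin_le_nhds (gt_mem_nhds (div_pos hρ hF0))]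
    with t hsmall ht0 htτ htρ
  have ht0 : 0 < t := ht0
  rw [lt_div_iff₀' hF0] at htρ
  have hdist : ∀ s, 0 ≤ s → ‖y s - x‖ ≤ F * s := fun s hs => by
    have := h.norm_sub_le hP hF le_rfl hs
    rwa [h.initial, sub_zero] at this
  have hmem : ∀ s, 0 ≤ s → s ≤ t → y s ∈ Metric.ball x ρ := fun s hs hst =>
    mem_ball_iff_norm.2 ((hdist s hs).trans_lt (lt_of_le_of_lt (by gcongr) htρ))
  have hxU : x ∈ U := mem_of_mem_nhds hU
  have hz : x + t • P.f x b ∈ U := by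
    refine (hball (mem_ball_iff_norm.2 (lt_of_le_of_lt ?_ htρ))).1
    rw [add_sub_cancel_left, norm_smul, Real.norm_of_nonneg ht0.le, mul_comm]
    exact mul_le_mul_of_nonneg_right (hF x hxc b hb.1) ht0.le
  -- the trajectory is tangent to its initial velocity
  have htan : ‖y t - (x + t • P.f x b)‖ ≤ L * F * t * t := by
    have e : y t - (x + t • P.f x b) =
        ∫ s in (0 : ℝ)..t, (P.f (y s) (if s ≤ τ then b else P.a₀) - P.f x b) := by
      rw [intervalIntegral.integral_sub (h.intervalIntegrable_f hP le_rfl ht0.le)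
        intervalIntegrable_const, intervalIntegral.integral_const, h.eq_integral t ht0.le, sub_zero]
      abel
    rw [e]
    refine (intervalIntegral.norm_integral_le_of_norm_le_const (C := L * F * t)
      fun s hs => ?_).trans_eq (by rw [sub_zero, abs_of_pos ht0])
    rw [uIoc_of_le ht0.le] at hs
    rw [if_pos (hs.2.trans htτ.le)]
    refine ((hL b hb.1).norm_sub_le (h.mem_closure s hs.1.le) hxc).trans ?_
    rw [mul_assoc]
    gcongr
    exact (hdist s hs.1.le).trans (by gcongr; exact hs.2)
  have hqy : ∀ s, 0 ≤ s → s ≤ t → P.q (y s) ≤ P.q x + C * (F * s) := fun s hs hst => by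
    have := (le_abs_self _).trans (hq.norm_sub_le (hball (hmem s hs hst)).1 hxU)
    have := mul_le_mul_of_nonneg_left (hdist s hs) C.coe_nonneg
    linarith
  have hqt : P.q (y t) ≤ P.q (x + t • P.f x b) + C * (L * F * t * t) := by
    have := (le_abs_self _).trans (hq.norm_sub_le (hball (hmem t ht0.le le_rfl)).1 hz)
    have := mul_le_mul_of_nonneg_left htan C.coe_nonneg
    linarith
  have hKt : ∫ s in (0 : ℝ)..t, P.K (y s) (if s ≤ τ then b else P.a₀) ≤
      (P.K x b + η / 2) * t := by
    rw [mul_comm]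
    have := intervalIntegral.integral_mono_on ht0.le (h.intervalIntegrable_K hP le_rfl ht0.le)
      (intervalIntegrable_const (c := P.K x b + η / 2)) fun s hs => by
        rw [if_pos (hs.2.trans htτ.le)]
        exact (hball (hmem s hs.1 hs.2)).2.le
    simpa only [intervalIntegral.integral_const, sub_zero, smul_eq_mul] using this
  have hK₂0 : 0 ≤ K₂ := (hP.nonneg_cost hxc hb.1).trans (hK₂ x hxc b hb.1)
  have hval := (hP.value_le_expMean_stopped hl h ht0.le).trans
    (expMean_stopped_le hl (h.expIntegrable_omega hP) ht0.le
      (b := P.q x + (K₂ + C * F) * t) fun s hs hst => by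
        have h1 := h.integral_K_le hP hK₂ hs.le
        have h2 := hqy s hs.le hst
        have h3 : (K₂ + C * F) * s ≤ (K₂ + C * F) * t := by gcongr
        simp only [omega]
        linarith)
  rw [hv] at hval
  have hexp : Real.exp (lam * t) * Real.exp (-lam * t) = 1 := by
    rw [← Real.exp_add]; simp
  have hω : P.q x - (Real.exp (lam * t) - 1) * ((K₂ + C * F) * t) ≤
      P.omega (fun t => if t ≤ τ then b else P.a₀) y t := by
    have := mul_le_mul_of_nonneg_left hval (Real.exp_pos (lam * t)).le
    have e : Real.exp (lam * t) * ((1 - Real.exp (-lam * t)) * (P.q x + (K₂ + C * F) * t) +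
        Real.exp (-lam * t) * P.omega (fun t => if t ≤ τ then b else P.a₀) y t) =
        (Real.exp (lam * t) - Real.exp (lam * t) * Real.exp (-lam * t)) *
          (P.q x + (K₂ + C * F) * t) + Real.exp (lam * t) * Real.exp (-lam * t) *
          P.omega (fun t => if t ≤ τ then b else P.a₀) y t := by ring
    rw [e, hexp] at this
    linarith
  norm_cast
  rw [le_div_iff₀ ht0]
  have := mul_lt_mul_of_pos_right hsmall ht0
  simp only [omega] at hω
  linarith

lemma localMinima_subset_motionlessInf (hP : P.Standing) :
    P.localMinima ⊆ P.motionlessInf := by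
  rintro x ⟨hx, hmin⟩
  refine ⟨hx, le_iInf₂ fun b hb => add_nonneg (by exact_mod_cast hP.nonneg_cost hx hb.1) ?_⟩
  refine le_liminf_of_le (by isBoundedDefault) ?_
  have hlim : Tendsto (fun t : ℝ => x + t • P.f x b)
      (𝓝[{t : ℝ | 0 < t ∧ x + t • P.f x b ∈ closure P.Ω}] 0) (𝓝[closure P.Ω] x) := by
    refine tendsto_nhdsWithin_iff.2 ⟨?_, ?_⟩
    · have : Continuous fun t : ℝ => x + t • P.f x b := by fun_prop
      simpa using (this.tendsto 0).mono_left nhdsWithin_le_nhds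
    · filter_upwards [self_mem_nhdsWithin] with t ht using ht.2
  filter_upwards [hlim.eventually hmin, self_mem_nhdsWithin] with t ht ht0
  exact_mod_cast div_nonneg (sub_nonneg.2 ht) ht0.1.le

lemma globalMinima_subset_motionless (hP : P.Standing) :
    P.globalMinima ⊆ P.motionless 0 := by
  rintro x ⟨hx, hmin⟩
  refine ⟨hx, (hP.value_le_q le_rfl hx).antisymm (le_of_not_gt fun hlt => ?_)⟩
  obtain ⟨a, y, T, h, hT, hc⟩ := hP.exists_omega_lt hx hlt
  exact hc.not_ge ((hmin (h.mem_closure T hT)).trans (h.q_le_omega hP hT))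

/-! ### Growth of the terminal cost near strictly stationary points -/

/-- On a compact set of velocities the lower bounds given by the Hadamard derivatives are
uniform. -/
lemma exists_uniform_growth (hx : x ∈ P.motionlessInfStrict)
    {B : Set (EuclideanSpace ℝ (Fin n))} (hB : IsCompact B) {κ : ℝ}
    (hBa : ∀ v ∈ B, ∃ b ∈ P.A \ {P.a₀}, P.f x b = v ∧ P.K x b = κ) :
    ∃ δ > 0, ∃ ρ > 0, ∀ v ∈ B, ∀ t, 0 < t → t < ρ → x + t • v ∈ closure P.Ω →
      P.q x + (δ - κ) * t ≤ P.q (x + t • v) := by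
  refine hB.induction_on (p := fun S => ∃ δ > 0, ∃ ρ > 0, ∀ v ∈ S, ∀ t, 0 < t → t < ρ →
    x + t • v ∈ closure P.Ω → P.q x + (δ - κ) * t ≤ P.q (x + t • v)) ?_ ?_ ?_ ?_
  · exact ⟨1, one_pos, 1, one_pos, by simp⟩
  · rintro S T hST ⟨δ, hδ, ρ, hρ, h⟩
    exact ⟨δ, hδ, ρ, hρ, fun v hv => h v (hST hv)⟩
  · rintro S T ⟨δ₁, hδ₁, ρ₁, hρ₁, h₁⟩ ⟨δ₂, hδ₂, ρ₂, hρ₂, h₂⟩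
    refine ⟨min δ₁ δ₂, lt_min hδ₁ hδ₂, min ρ₁ ρ₂, lt_min hρ₁ hρ₂, ?_⟩
    rintro v (hv | hv) t ht htρ hc
    · refine le_trans ?_ (h₁ v hv t ht (htρ.trans_le (min_le_left _ _)) hc)
      gcongr
      exact min_le_left _ _
    · refine le_trans ?_ (h₂ v hv t ht (htρ.trans_le (min_le_right _ _)) hc)
      gcongr
      exact min_le_right _ _
  · intro v hv
    obtain ⟨b, hb, rfl, rfl⟩ := hBa v hv
    obtain ⟨δ, hδ, hlt⟩ := exists_pos_lt_of_coe_add_pos (hx.2 b hb)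
    have hev := eventually_lt_of_lt_liminf hlt
    rw [eventually_nhdsWithin_iff, Metric.eventually_nhds_iff] at hev
    obtain ⟨ρ, hρ, h⟩ := hev
    refine ⟨Metric.ball (P.f x b) ρ, mem_nhdsWithin_of_mem_nhds (Metric.ball_mem_nhds _ hρ),
      δ, hδ, ρ, hρ, fun v hv t ht htρ hc => ?_⟩
    have := h (y := (t, v)) (by
      rw [Prod.dist_eq, max_lt_iff, Real.dist_eq, sub_zero, abs_of_pos ht]
      exact ⟨htρ, hv⟩) ⟨ht, hc⟩
    norm_cast at this
    rw [lt_div_iff₀ ht] at this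
    linarith

lemma Standing.motionlessInfStrict_subset_strictLocalMinima (hP : P.Standing)
    (hC : P.Controllable) (hK : ∀ x ∈ closure P.Ω, ∀ a ∈ P.A, P.K x a = 0) :
    P.motionlessInfStrict ⊆ P.strictLocalMinima := by
  intro x hx
  obtain ⟨-, F₁, hF₁, hdir⟩ := hC
  have hcont := hP.continuous x hx.1
  -- the control values with speed at least `F₁` reach all directions
  set S : Set (EuclideanSpace ℝ (Fin m)) := P.A ∩ (fun b => ‖P.f x b‖) ⁻¹' Ici F₁
  have hS : IsCompact S :=
    hP.isCompact.of_isClosed_subset (hcont.norm.preimage_isClosed_of_isClosed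
      hP.isCompact.isClosed isClosed_Ici) inter_subset_left
  obtain ⟨δ, hδ, ρ, hρ, h⟩ := exists_uniform_growth hx (κ := 0)
    (hS.image_of_continuousOn (hcont.mono inter_subset_left)) (by
      rintro _ ⟨b, hb, rfl⟩
      refine ⟨b, ⟨hb.1, ?_⟩, rfl, hK x hx.1 b hb.1⟩
      rintro rfl
      have := hb.2
      simp only [mem_preimage, hP.f_motionless x hx.1, norm_zero, mem_Ici] at this
      linarith)
  refine ⟨hx.1, ?_⟩
  filter_upwards [self_mem_nhdsWithin, nhdsWithin_le_nhds (Metric.ball_mem_nhds x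
    (mul_pos hρ hF₁))] with z hz hzb
  have hzx : 0 < ‖z - x‖ := norm_pos_iff.2 (sub_ne_zero.2 hz.2)
  rw [mem_ball_iff_norm] at hzb
  obtain ⟨b, hb, hin, hFb⟩ := hdir x hx.1 (‖z - x‖⁻¹ • (z - x)) (by
    rw [norm_smul, norm_inv, norm_norm, inv_mul_cancel₀ hzx.ne'])
  have hfb : 0 < ‖P.f x b‖ := hF₁.trans_le hFb
  have hpar : z - x = (‖z - x‖ / ‖P.f x b‖) • P.f x b := by
    rw [inner_smul_left, RCLike.conj_to_real, inv_mul_eq_iff_eq_mul₀ hzx.ne',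
      inner_eq_norm_mul_iff_real] at hin
    rw [div_eq_inv_mul, mul_smul, ← hin, smul_smul, inv_mul_cancel₀ hfb.ne', one_smul]
  have ht : 0 < ‖z - x‖ / ‖P.f x b‖ := div_pos hzx hfb
  have := h (P.f x b) ⟨b, ⟨hb, hFb⟩, rfl⟩ _ ht ((div_lt_iff₀ hfb).2 (hzb.trans_le (by gcongr)))
    (by rw [← hpar, add_sub_cancel]; exact hz.1)
  rw [← hpar, add_sub_cancel, sub_zero] at this
  have := mul_pos hδ ht
  linarith

/-! ### The isotropic case -/

/-- Near a strictly stationary point with positive speed, the running cost per unit length is at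
least `θ`, and the terminal cost decreases by less than `θ` per unit length. -/
lemma Standing.exists_cost_bounds (hP : P.Standing)
    {e : Metric.sphere (0 : EuclideanSpace ℝ (Fin n)) 1 → EuclideanSpace ℝ (Fin m)}
    {speed cost : EuclideanSpace ℝ (Fin n) → ℝ} (hrange : range e = P.A \ {P.a₀})
    (he : ∀ x ∈ closure P.Ω, 0 ≤ speed x ∧
      ∀ u : Metric.sphere (0 : EuclideanSpace ℝ (Fin n)) 1,
        P.f x (e u) = speed x • (u : EuclideanSpace ℝ (Fin n)) ∧ P.K x (e u) = cost x)
    (hx : x ∈ P.motionlessInfStrict) (hs : 0 < speed x) :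
    ∃ θ ≥ 0, ∃ c > 0, ∃ r > 0, ∀ z ∈ closure P.Ω, ‖z - x‖ ≤ r →
      (∀ b ∈ P.A, θ * ‖P.f z b‖ ≤ P.K z b) ∧ P.q x + (c - θ) * ‖z - x‖ ≤ P.q z := by
  have hmem : ∀ u, e u ∈ P.A \ {P.a₀} := fun u => hrange ▸ mem_range_self u
  obtain ⟨δ, hδ, ρ, hρ, h⟩ := exists_uniform_growth hx (κ := cost x)
    ((isCompact_sphere (0 : EuclideanSpace ℝ (Fin n)) 1).image
      (continuous_const_smul (speed x))) (by
      rintro _ ⟨u, hu, rfl⟩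
      exact ⟨e ⟨u, hu⟩, hmem _, (he x hx.1).2 ⟨u, hu⟩⟩)
  set θ := max (cost x - δ / 2) 0 / speed x with hθ
  have hθ0 : 0 ≤ θ := div_nonneg (le_max_right _ _) hs.le
  have hspeed : ∀ z ∈ closure P.Ω, ∀ u, ‖P.f z (e u)‖ = speed z := fun z hz u => by
    rw [((he z hz).2 u).1, norm_smul, Real.norm_of_nonneg (he z hz).1, norm_eq_of_mem_sphere,
      mul_one]
  have hcost : ∀ᶠ z in 𝓝[closure P.Ω] x,
      ∀ u : Metric.sphere (0 : EuclideanSpace ℝ (Fin n)) 1, θ * speed z ≤ P.K z (e u) := by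
    rcases isEmpty_or_nonempty (Metric.sphere (0 : EuclideanSpace ℝ (Fin n)) 1) with hE | ⟨⟨u₀⟩⟩
    · exact Eventually.of_forall fun z u => isEmptyElim u
    obtain ⟨L, hL⟩ := hP.lipschitz
    rcases le_or_gt (cost x - δ / 2) 0 with hc | hc
    · have : θ = 0 := by rw [hθ, max_eq_right hc, zero_div]
      filter_upwards [self_mem_nhdsWithin] with z hz u
      rw [this, zero_mul]
      exact hP.nonneg_cost hz (hmem u).1
    · have hlsc := (hP.K_lsc.comp (g := fun z => (z, e u₀)) (t := closure P.Ω) (by fun_prop)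
        fun z hz => ⟨hz, (hmem u₀).1⟩) x hx.1 (cost x - δ / 4) (by
          simp only [Function.comp_apply, Function.uncurry, ((he x hx.1).2 u₀).2]; linarith)
      have hlim : Tendsto (fun z => θ * ‖P.f z (e u₀)‖) (𝓝[closure P.Ω] x)
          (𝓝 (cost x - δ / 2)) := by
        have h1 := (((hL _ (hmem u₀).1).continuousOn x hx.1).norm).const_mul θ
        rw [ContinuousWithinAt, hspeed x hx.1] at h1
        rwa [show θ * speed x = cost x - δ / 2 by
          rw [hθ, max_eq_left hc.le, div_mul_cancel₀ _ hs.ne']] at h1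
      filter_upwards [hlsc, hlim.eventually (gt_mem_nhds (show cost x - δ / 2 < cost x - δ / 4 by
        linarith)), self_mem_nhdsWithin] with z h1 h2 hz u
      rw [hspeed z hz] at h2
      simp only [Function.comp_apply, Function.uncurry, ((he z hz).2 u₀).2] at h1
      rw [((he z hz).2 u).2]
      exact (h2.trans h1).le
  obtain ⟨r, hr, hball⟩ := Metric.mem_nhdsWithin_iff.1 hcost
  refine ⟨θ, hθ0, δ / (2 * speed x), by positivity, min (r / 2) (ρ * speed x / 2), by positivity,
    fun z hz hzr => ⟨fun b hb => ?_, ?_⟩⟩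
  · by_cases hb0 : b = P.a₀
    · rw [hb0, hP.f_motionless z hz, norm_zero, mul_zero]
      exact hP.nonneg_cost hz hP.mem
    · obtain ⟨u, rfl⟩ : b ∈ range e := hrange ▸ ⟨hb, hb0⟩
      rw [hspeed z hz]
      refine hball ⟨mem_ball_iff_norm.2 ?_, hz⟩ u
      have := hzr.trans (min_le_left _ _)
      linarith
  · rcases eq_or_ne z x with rfl | hne
    · simp
    have hzx : 0 < ‖z - x‖ := norm_pos_iff.2 (sub_ne_zero.2 hne)
    have hpar : z - x = (‖z - x‖ / speed x) • speed x • ‖z - x‖⁻¹ • (z - x) := by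
      rw [smul_smul, smul_smul, div_mul_cancel₀ _ hs.ne', mul_inv_cancel₀ hzx.ne', one_smul]
    have := h (speed x • ‖z - x‖⁻¹ • (z - x)) ⟨_, by
        rw [mem_sphere_zero_iff_norm, norm_smul, norm_inv, norm_norm, inv_mul_cancel₀ hzx.ne'],
        rfl⟩ _ (div_pos hzx hs) (by
        rw [div_lt_iff₀ hs]
        have := hzr.trans (min_le_right _ _)
        have := mul_pos hρ hs
        linarith) (by rw [← hpar, add_sub_cancel]; exact hz)
    rw [← hpar, add_sub_cancel] at this
    refine le_trans ?_ this
    have h1 : δ / (2 * speed x) - θ ≤ (δ - cost x) / speed x := by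
      rw [hθ, ← div_div, ← sub_div]
      refine div_le_div_of_nonneg_right ?_ hs.le
      linarith [le_max_left (cost x - δ / 2) 0]
    have := mul_le_mul_of_nonneg_right h1 hzx.le
    rw [mul_div_assoc', ← div_mul_eq_mul_div]
    linarith

/-- While the trajectory stays where the bounds of the hypothesis hold, the running cost outweighs
the gain in the terminal cost by a multiple of the distance from `x`. -/
lemma IsTrajectory.le_omega_of_cost_bounds (hP : P.Standing) (h : P.IsTrajectory x a y)
    {θ c r t : ℝ} (hθ : 0 ≤ θ) (hr : ∀ z ∈ closure P.Ω, ‖z - x‖ ≤ r →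
      (∀ b ∈ P.A, θ * ‖P.f z b‖ ≤ P.K z b) ∧ P.q x + (c - θ) * ‖z - x‖ ≤ P.q z)
    (ht : 0 ≤ t) (hy : ∀ s, 0 ≤ s → s ≤ t → ‖y s - x‖ ≤ r) :
    P.q x + c * ‖y t - x‖ ≤ P.omega a y t := by
  have h1 : θ * ‖y t - x‖ ≤ ∫ s in (0 : ℝ)..t, P.K (y s) (a s) := by
    have e := h.sub_eq_integral hP le_rfl ht
    rw [h.initial] at e
    rw [e]
    refine (mul_le_mul_of_nonneg_left (intervalIntegral.norm_integral_le_integral_norm ht) hθ).trans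
      ?_
    rw [← intervalIntegral.integral_const_mul]
    exact intervalIntegral.integral_mono_on ht
      ((h.intervalIntegrable_f hP le_rfl ht).norm.const_mul θ) (h.intervalIntegrable_K hP le_rfl ht)
      fun s hs => (hr _ (h.mem_closure s hs.1) (hy s hs.1 hs.2)).1 _ (h.mem_controls s)
  have h2 := (hr _ (h.mem_closure t ht) (hy t ht le_rfl)).2
  simp only [omega]
  linarith

/-- A control that leaves the ball of radius `r` about `x` has an excess of cost for some time
before, which for large rates outweighs whatever is gained later. -/
lemma Standing.mem_motionless_of_cost_bounds (hP : P.Standing) (hx : x ∈ closure P.Ω)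
    {θ c r : ℝ} (hθ : 0 ≤ θ) (hc : 0 < c) (hr0 : 0 < r)
    (hr : ∀ z ∈ closure P.Ω, ‖z - x‖ ≤ r →
      (∀ b ∈ P.A, θ * ‖P.f z b‖ ≤ P.K z b) ∧ P.q x + (c - θ) * ‖z - x‖ ≤ P.q z) :
    ∀ᶠ lam : ℝ in atTop, x ∈ P.motionless lam := by
  obtain ⟨F, hF0, hF⟩ := hP.exists_speed_bound
  set d := r / (2 * F) with hd
  have hd0 : 0 < d := by positivity
  have hlim : Tendsto (fun lam : ℝ => c * (r / 2) * (Real.exp (lam * d) - 1)) atTop atTop :=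
    (tendsto_atTop_add_const_right _ (-1) (Real.tendsto_exp_atTop.comp
      (tendsto_id.atTop_mul_const hd0))).const_mul_atTop (by positivity)
  filter_upwards [hlim.eventually_ge_atTop (P.q x), eventually_gt_atTop 0] with lam hlam hl
  refine ⟨hx, (hP.value_le_q hl.le hx).antisymm (hP.le_value hl hx fun a y h => ?_)⟩
  by_cases hstay : ∀ t, 0 ≤ t → ‖y t - x‖ ≤ r
  · refine (expMean_const hl _).symm.trans_le (expMean_mono hl (expIntegrable_const _)
      (h.expIntegrable_omega hP) fun t ht => ?_)
    have := h.le_omega_of_cost_bounds hP hθ hr ht.le fun s hs _ => hstay s hs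
    have : 0 ≤ c * ‖y t - x‖ := by positivity
    linarith
  push Not at hstay
  obtain ⟨t₁, ht₁, hyt₁⟩ := hstay
  -- `σ` is the time at which the trajectory reaches the sphere of radius `r`
  set E : Set ℝ := Ici 0 ∩ (fun t => ‖y t - x‖) ⁻¹' Ici r
  have hE : IsClosed E := (h.continuousOn.sub continuousOn_const).norm.preimage_isClosed_of_isClosed
    isClosed_Ici isClosed_Ici
  have hEb : BddBelow E := ⟨0, fun t ht => ht.1⟩
  obtain ⟨hσ0, hσ⟩ : sInf E ∈ E := hE.csInf_mem ⟨t₁, ht₁, hyt₁.le⟩ hEb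
  set σ := sInf E
  have hin : ∀ t, 0 ≤ t → t < σ → ‖y t - x‖ ≤ r := fun t ht htσ => by
    by_contra! hlt
    exact htσ.not_ge (csInf_le hEb ⟨ht, hlt.le⟩)
  have hdist : ∀ t, 0 ≤ t → t ≤ σ → r - F * (σ - t) ≤ ‖y t - x‖ := fun t ht htσ => by
    have h1 := h.norm_sub_le hP hF ht htσ
    have h2 := norm_sub_le_norm_sub_add_norm_sub (y σ) (y t) x
    have h3 : r ≤ ‖y σ - x‖ := hσ
    linarith
  have hFd : F * d = r / 2 := by rw [hd]; field_simp
  have hdσ : d ≤ σ := by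
    have := hdist 0 le_rfl hσ0
    rw [h.initial, sub_self, norm_zero] at this
    by_contra! hlt
    have := mul_lt_mul_of_pos_left hlt hF0
    linarith
  have hgain : ∀ t, 0 ≤ t → t < σ → P.q x + c * ‖y t - x‖ ≤ P.omega a y t := fun t ht htσ =>
    h.le_omega_of_cost_bounds hP hθ hr ht fun s hs hst => hin s hs (hst.trans_lt htσ)
  have := le_expMean_of_step hl (h.expIntegrable_omega hP) (b := P.q x) (c := c * (r / 2))
    (s := σ - d) (τ := σ) (sub_nonneg.2 hdσ) (by linarith)
    (fun t ht hts => by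
      have h1 := hgain t ht.le (by linarith)
      have h2 : 0 ≤ c * ‖y t - x‖ := by positivity
      linarith)
    (fun t hst htσ => by
      have ht : 0 ≤ t := by linarith
      have h1 := hgain t ht htσ
      have h2 := hdist t ht htσ.le
      have h3 : F * (σ - t) ≤ F * d := by gcongr; linarith
      have h4 : c * (r / 2) ≤ c * ‖y t - x‖ := by gcongr; linarith
      linarith)
    (fun t ht => h.omega_nonneg hP (le_trans hσ0 ht.le))
  refine le_trans ?_ this
  rw [show -lam * (σ - d) = lam * d + -lam * σ by ring, Real.exp_add]
  have := mul_le_mul_of_nonneg_right hlam (Real.exp_pos (-lam * σ)).le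
  linarith

/-- A trajectory never leaves a point at which all velocities vanish. -/
lemma IsTrajectory.eq_of_forall_f_eq_zero (hP : P.Standing) (h : P.IsTrajectory x a y)
    (hx : ∀ b ∈ P.A, P.f x b = 0) {t : ℝ} (ht : 0 ≤ t) : y t = x := by
  obtain ⟨L, hL⟩ := hP.lipschitz
  have hcont : ContinuousOn (fun s => ‖y s - x‖) (Ici 0) :=
    (h.continuousOn.sub continuousOn_const).norm
  have hint : ∀ s, 0 ≤ s → IntervalIntegrable (fun s => ‖y s - x‖) volume 0 s := fun s hs =>
    (hcont.mono (by rw [uIcc_of_le hs]; exact Icc_subset_Ici_self)).intervalIntegrable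
  have hle : ∀ s, 0 ≤ s → ‖y s - x‖ ≤ L * ∫ r in (0 : ℝ)..s, ‖y r - x‖ := fun s hs => by
    have e := h.sub_eq_integral hP le_rfl hs
    rw [h.initial] at e
    rw [e, ← intervalIntegral.integral_const_mul]
    refine (intervalIntegral.norm_integral_le_integral_norm hs).trans ?_
    refine intervalIntegral.integral_mono_on hs (h.intervalIntegrable_f hP le_rfl hs).norm
      ((hint s hs).const_mul _) fun r hr => ?_
    have := (hL _ (h.mem_controls r)).norm_sub_le (h.mem_closure r hr.1) h.mem_closure_initial
    rwa [hx _ (h.mem_controls r), sub_zero] at this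
  -- Gronwall's inequality for the integral of the distance
  have hzero := eq_zero_of_abs_deriv_le_mul_abs_self_of_eq_zero_right
    (f := fun s => ∫ r in (0 : ℝ)..s, ‖y r - x‖) (f' := fun s => ‖y s - x‖) (K := L) (a := 0)
    (b := t) (by
      have := intervalIntegral.continuousOn_primitive_interval (μ := volume)
        (f := fun s => ‖y s - x‖) (a := 0) (b := t) (by
          rw [uIcc_of_le ht]
          exact (hcont.mono Icc_subset_Ici_self).integrableOn_Icc)
      rwa [uIcc_of_le ht] at this)
    (fun s hs => intervalIntegral.integral_hasDerivWithinAt_right (hint s hs.1)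
      ((hcont.mono (Ici_subset_Ici.2 hs.1)).stronglyMeasurableAtFilter_nhdsWithin measurableSet_Ici
        s |>.filter_mono (nhdsWithin_mono _ Ioi_subset_Ici_self))
      ((hcont s hs.1).mono (Ioi_subset_Ici_self.trans (Ici_subset_Ici.2 hs.1))))
    (by simp) (fun s hs => by
      have h0 : 0 ≤ ∫ r in (0 : ℝ)..s, ‖y r - x‖ :=
        intervalIntegral.integral_nonneg hs.1 fun r _ => norm_nonneg _
      rw [Real.norm_of_nonneg h0, norm_norm]
      exact hle s hs.1) t (right_mem_Icc.2 ht)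
  have := hle t ht
  rw [hzero, mul_zero] at this
  exact sub_eq_zero.1 (norm_le_zero_iff.1 this)

lemma Standing.eventually_mem_motionless_of_isIsotropic (hP : P.Standing) (hI : P.IsIsotropic)
    (hx : x ∈ P.motionlessInfStrict) : ∀ᶠ lam : ℝ in atTop, x ∈ P.motionless lam := by
  obtain ⟨e, speed, cost, -, -, hrange, he⟩ := hI
  rcases (he x hx.1).1.eq_or_lt with hs | hs
  · filter_upwards [eventually_gt_atTop 0] with lam hl
    have hf : ∀ b ∈ P.A, P.f x b = 0 := fun b hb => by
      by_cases hb0 : b = P.a₀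
      · rw [hb0, hP.f_motionless x hx.1]
      · obtain ⟨u, rfl⟩ : b ∈ range e := hrange ▸ ⟨hb, hb0⟩
        rw [((he x hx.1).2 u).1, ← hs, zero_smul]
    refine ⟨hx.1, (hP.value_le_q hl.le hx.1).antisymm (hP.le_value hl hx.1 fun a y h => ?_)⟩
    refine (expMean_const hl _).symm.trans_le (expMean_mono hl (expIntegrable_const _)
      (h.expIntegrable_omega hP) fun t ht => ?_)
    have := h.q_le_omega hP ht.le
    rwa [h.eq_of_forall_f_eq_zero hP hf ht.le] at this
  · obtain ⟨θ, hθ, c, hc, r, hr, hb⟩ := hP.exists_cost_bounds hrange he hx hs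
    exact hP.mem_motionless_of_cost_bounds hx.1 hθ hc hr hb

end ControlProblem

theorem mainTheorem3 {n m : ℕ} (P : ControlProblem n m) (hP : P.Standing)
    (hopt : ∀ x ∈ P.Ω, ∀ lam : ℝ, 0 ≤ lam → ∃ a y T, P.IsOptimalEM lam x a y T) :
    -- 1. the deterministic cost along an optimal eventually motionless trajectory
    (∀ x ∈ closure P.Ω, ∀ lam : ℝ, 0 ≤ lam → ∀ a y t₀, P.IsOptimalEM lam x a y t₀ →
      ∀ t, 0 ≤ t → t < t₀ →
        P.omega a y t₀ ≤ P.omega a y t ∧ P.q (y t₀) ≤ P.q (y t) ∧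
        (0 < P.infRunningCost (closure P.Ω) →
          (¬ ∀ᵐ s ∂(volume.restrict (Set.Ioi t)), a s = P.a₀) → P.q (y t₀) < P.q (y t))) ∧
    -- 2. bounds
    (∀ lam : ℝ, 0 < lam → ∀ x ∈ closure P.Ω, P.value lam x ∈ Set.Icc (P.value 0 x) (P.q x)) ∧
    -- 3. monotonicity in the rate
    (∀ lam₁ lam₂ : ℝ, 0 ≤ lam₁ → lam₁ ≤ lam₂ → ∀ x ∈ closure P.Ω,
      P.value lam₁ x ≤ P.value lam₂ x) ∧
    -- 4. limit for large rates
    (∀ x ∈ closure P.Ω, Filter.Tendsto (fun lam => P.value lam x) Filter.atTop (nhds (P.q x))) ∧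
    -- 5. limit for small rates
    (∀ x ∈ closure P.Ω,
      Filter.Tendsto (fun lam => P.value lam x) (nhdsWithin 0 (Set.Ioi 0))
        (nhds (P.value 0 x))) ∧
    -- 6. the motionless sets
    ((∀ lam₁ lam₂ : ℝ, 0 ≤ lam₁ → lam₁ ≤ lam₂ → P.motionless lam₁ ⊆ P.motionless lam₂) ∧
      (∀ lam : ℝ, 0 < lam → P.motionless 0 ⊆ P.motionless lam) ∧
      (∀ lam : ℝ, 0 ≤ lam → P.motionless lam ∩ P.regularPoints ⊆ P.motionlessInf)) ∧
    -- 7. the isotropic case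
    (P.IsIsotropic → 0 < P.infRunningCost P.Ω → ∀ x ∈ P.motionlessInfStrict,
      ∀ᶠ lam : ℝ in Filter.atTop, x ∈ P.motionless lam) ∧
    -- 8. points that are not motionless for small rates
    (∀ x ∈ closure P.Ω, x ∉ P.motionless 0 →
      ∀ᶠ lam : ℝ in nhdsWithin 0 (Set.Ioi 0), x ∉ P.motionless lam) ∧
    -- 9. minima of the terminal cost
    (P.globalMinima ⊆ P.motionless 0 ∧ P.localMinima ⊆ P.motionlessInf ∧
      (P.Controllable → (∀ x ∈ closure P.Ω, ∀ a ∈ P.A, P.K x a = 0) →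
        P.motionlessInfStrict ⊆ P.strictLocalMinima)) := by
  refine ⟨fun x _ lam hl a y t₀ ho t ht htt₀ => ?_,
    fun lam hl x hx => ⟨hP.value_zero_le hl hx, hP.value_le_q hl.le hx⟩,
    fun lam₁ lam₂ h₁ h₂ x hx => hP.value_mono h₁ h₂ hx, fun x hx => hP.tendsto_value_atTop hx,
    fun x hx => hP.tendsto_value_zero hx,
    ⟨fun lam₁ lam₂ h₁ h₂ => hP.motionless_mono h₁ h₂,
      fun lam hl => hP.motionless_mono le_rfl hl.le, fun lam hl => ?_⟩,
    fun hI _ x hx => hP.eventually_mem_motionless_of_isIsotropic hI hx, fun x hx hx0 => ?_,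
    ControlProblem.globalMinima_subset_motionless hP,
    ControlProblem.localMinima_subset_motionlessInf hP,
    fun hC hK => hP.motionlessInfStrict_subset_strictLocalMinima hC hK⟩
  · have hq := ho.q_add_integral_le hP hl ht htt₀.le
    refine ⟨ho.omega_le hP hl ht htt₀.le, ?_, fun hK hne => ?_⟩
    · have := ho.trajectory.integral_K_nonneg hP ht htt₀.le
      linarith
    · have := ho.trajectory.integral_K_pos hP hK ht htt₀.le ho.motionless hne
      linarith
  · -- the positive rate `lam + 1` is used since `lam` may be zero
    refine Subset.trans (inter_subset_inter_left _ ?_)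
      (hP.motionless_regular_subset (lam := lam + 1) (by linarith))
    exact hP.motionless_mono hl (by linarith)
  · have hlt : P.value 0 x < P.q x :=
      (hP.value_le_q le_rfl hx).lt_of_ne fun h => hx0 ⟨hx, h⟩
    filter_upwards [(hP.tendsto_value_zero hx).eventually (gt_mem_nhds hlt)] with lam h hmem
    exact h.ne hmem.2
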